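/- Setting. Let $N$ be the number of antennas, $M$ the number of users and $L\le N$ the number of antennas that may be active. Let $H=[h_1,\dots,h_M]\in\mathbb C^{N\times M}$, and for each user $m$ let $\sigma_m>0$, $\gamma_m>0$. For a beamforming matrix $W=[w_1,\dots,w_M]\in\mathbb C^{N\times M}$ and $h\in\mathbb C^N$ put $$\mathrm{SINR}_m(W,h)=\frac{|w_m^H h|^2}{\sum_{\ell\ne m}|w_\ell^H h|^2+\sigma_m^2}.$$ In the perfect-CSI case (BF) let $\mathcal C_m(W)=\mathrm{SINR}_m(W,h_m)$. In the imperfect-CSI case (RBF) let, in addition, $\varepsilon_m>0$ for all $m$, $\mathcal U_m=\{h_m+e:\|e\|_2\le\varepsilon_m\}$ and $\mathcal C_m(W)=\min_{\bar h\in\mathcal U_m}\mathrm{SINR}_m(W,\bar h)$. A node is a pair of disjoint sets $\mathcal A,\mathcal B\subseteq[N]$ (activated and shut-down antennas) with $|\mathcal A|\le L$ and $|\mathcal B|\le N-L$. The node problem is $$\min_W\|W\|_F^2\quad\text{s.t. } \mathcal C_m(W)\ge\gamma_m\ \forall m,\quad W(n,:)=0\ \forall n\in\mathcal B,\quad \|W\|_{\text{row-}0}\le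 L,$$ where $\|W\|_{\text{row-}0}$ is the number of nonzero rows. For $\mathcal B'\subseteq[N]$ let $(R_{\mathcal B'})$ be the problem $$\min_W\|W\|_F^2\quad\text{s.t. } \mathcal C_m(W)\ge\gamma_m\ \forall m,\quad W(n,:)=0\ \forall n\in\mathcal B';$$ $(R_{\mathcal B})$ is the node relaxation. The optimal value of an infeasible problem is $+\infty$. (a) In the BF case, for every node, $(R_{\mathcal B})$ is solved optimally by the second-order cone program in $(W,t)\in\mathbb C^{N\times M}\times\mathbb R$ $$\min\ t\quad\text{s.t. }\|(2W,\,t-1)\|_2\le t+1,\quad \sqrt{\textstyle\sum_{\ell\ne m}|w_\ell^Hh_m|^2/\sigma_m^2+1}\le\frac{\mathrm{Re}(w_m^Hh_m)}{\sqrt{\gamma_m\sigma_m^2}}\ \forall m,\quad W(n,:)=0\ \forall n\in\mathcal B$$ (the first constraint says $\|W\|_F^2\le t$). That is: the two problems have the same optimal value; if $(R_{\mathcal B})$ is feasible, the cone program has an optimal solution; and for each optimal solution $(W,t)$ of the cone program, $W$ is an optimal solution of $(R_{\mathcal B})$. (b) In the RBF case, assume that for every $\mathcal S\subseteq[N]$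 with $|\mathcal S|\ge L$, the matrix $\widetilde H=H(\mathcal S,:)$ with columns $\tilde h_m$ satisfies, for all $m$, $$\frac{\|\Pi_m\tilde h_m\|_2^2}{\varepsilon_m^2}>1+M+\Bigl(M-\frac1M\Bigr)\gamma_m,\qquad \Pi_m=I-\widetilde H_{-m}(\widetilde H_{-m}^H\widetilde H_{-m})^{-1}\widetilde H_{-m}^H,$$ where $\widetilde H_{-m}$ is $\widetilde H$ without column $m$ and the inverse is assumed to exist. Then, for every node, $(R_{\mathcal B})$ is solved optimally by its semidefinite relaxation $$\min_{X_1,\dots,X_M\succeq0}\ \sum_m\mathrm{Tr}(X_m)\quad\text{s.t. }\min_{\bar h\in\mathcal U_m}\frac{\bar h^HX_m\bar h}{\sum_{j\ne m}\bar h^HX_j\bar h+\sigma_m^2}\ge\gamma_m,\quad X_m(n,:)=0\ \forall n\in\mathcal B,\ \forall m.$$ That is: the two problems have the same optimal value; if $(R_{\mathcal B})$ is feasible, the semidefinite relaxation has an optimal solution; and each of its optimal solutions satisfies $\mathrm{rank}\,X_m=1$ for all $m$, can be written as $X_m=w_mw_m^H$, and every $W=[w_1,\dots,w_M]$ with $X_m=w_mw_m^H$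 for all $m$ is an optimal solution of $(R_{\mathcal B})$. (c) In the BF case, and in the RBF case under the assumption of (b), let $W$ be an optimal solution of $(R_{\mathcal B})$ at a node. Then there is a set $\mathcal C\subseteq[N]\setminus(\mathcal A\cup\mathcal B)$ of undecided antennas with $|\mathcal C\cup\mathcal B|=N-L$ whose powers $\|W(i,:)\|_2^2$ are lowest, i.e. $\|W(i,:)\|_2^2\le\|W(j,:)\|_2^2$ for all $i\in\mathcal C$ and all undecided $j\notin\mathcal C$. For every such $\mathcal C$, with $\widetilde{\mathcal B}=\mathcal C\cup\mathcal B$, the problem $(R_{\widetilde{\mathcal B}})$ is solved optimally by its second-order cone program (BF) or its semidefinite relaxation (RBF) in the sense of (a) and (b), its feasible points are feasible for the node problem, and its optimal value is an upper bound of the optimal value of the node problem. -/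

import Mathlib

noncomputable section

namespace AntennaSelection

open Matrix
open scoped ComplexOrder

/-! ### Optimization problems -/

/-- `x` solves `minimize f over S`. -/
def IsOptimal {X : Type*} (f : X → ℝ) (S : Set X) (x : X) : Prop :=
  x ∈ S ∧ IsMinOn f S x

/-- The optimal value of `minimize f over S`; it is `+∞` when `S` is empty. -/
def optValue {X : Type*} (f : X → ℝ) (S : Set X) : EReal :=
  ⨅ x ∈ S, ((f x : ℝ) : EReal)

/-- A second-order cone constraint `‖A x + b‖₂ ≤ c x + d` on a real vector space `V`, where the
linear map `A` and the vector `b` are given row by row. -/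
structure SOCConstraint (V : Type*) [AddCommGroup V] [Module ℝ V] where
  Row : Type
  [finRow : Fintype Row]
  A : Row → V →ₗ[ℝ] ℝ
  b : Row → ℝ
  c : V →ₗ[ℝ] ℝ
  d : ℝ

attribute [instance] SOCConstraint.finRow

def SOCConstraint.Holds {V : Type*} [AddCommGroup V] [Module ℝ V] (K : SOCConstraint V)
    (x : V) : Prop :=
  √(∑ k, (K.A k x + K.b k) ^ 2) ≤ K.c x + K.d

/-- A second-order cone program on a finite-dimensional real vector space `V`: minimize a linear
functional subject to finitely many second-order cone constraints and finitely many linear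
equations `F j x = g j`. -/
structure SOCP (V : Type*) [AddCommGroup V] [Module ℝ V] [FiniteDimensional ℝ V] where
  Cone : Type
  [finCone : Fintype Cone]
  Eqn : Type
  [finEqn : Fintype Eqn]
  obj : V →ₗ[ℝ] ℝ
  cone : Cone → SOCConstraint V
  F : Eqn → V →ₗ[ℝ] ℝ
  g : Eqn → ℝ

def SOCP.feasible {V : Type*} [AddCommGroup V] [Module ℝ V] [FiniteDimensional ℝ V]
    (P : SOCP V) : Set V :=
  {x | (∀ i, (P.cone i).Holds x) ∧ ∀ j, P.F j x = P.g j}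

/-! ### Beamforming -/

/-- Euclidean norm of a complex vector. -/
def l2 {ι : Type*} [Fintype ι] (x : ι → ℂ) : ℝ :=
  ‖(WithLp.toLp 2 x : EuclideanSpace ℂ ι)‖

/-- Data of a downlink scenario with `N` antennas and `M` users: column `m` of `H` is the (exact or
approximate) channel of user `m`, `ε m` the bound on the channel error, `σ m ^ 2` the noise
variance and `γ m` the required SINR. -/
structure Scenario (N M : ℕ) where
  H : Matrix (Fin N) (Fin M) ℂ
  ε : Fin M → ℝ
  σ : Fin M → ℝ
  γ : Fin M → ℝ

/-- `BF`: perfect channel state information. `RBF`: imperfect channel state information. -/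
inductive CSI
  | BF
  | RBF

variable {N M L : ℕ}

/-- `‖W‖_F²`. -/
def power (W : Matrix (Fin N) (Fin M) ℂ) : ℝ :=
  ∑ n, ∑ m, ‖W n m‖ ^ 2

/-- The number of nonzero rows. -/
def rowZero (W : Matrix (Fin N) (Fin M) ℂ) : ℕ :=
  {n | W n ≠ 0}.ncard

/-- `w_ℓᴴ h`, where `w_ℓ` is column `ℓ` of `W`. -/
def gain (W : Matrix (Fin N) (Fin M) ℂ) (l : Fin M) (h : Fin N → ℂ) : ℂ :=
  star (W.col l) ⬝ᵥ h

/-- SINR of user `m` if its channel is `h`. -/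
def sinr (D : Scenario N M) (W : Matrix (Fin N) (Fin M) ℂ) (m : Fin M) (h : Fin N → ℂ) : ℝ :=
  ‖gain W m h‖ ^ 2 / (∑ l ∈ Finset.univ.erase m, ‖gain W l h‖ ^ 2 + D.σ m ^ 2)

/-- `U_m = {h_m + e : ‖e‖₂ ≤ ε_m}`. -/
def uncertainty (D : Scenario N M) (m : Fin M) : Set (Fin N → ℂ) :=
  {h | ∃ e : Fin N → ℂ, l2 e ≤ D.ε m ∧ h = D.H.col m + e}

/-- The quality of service of user `m`: its SINR, or its worst-case SINR over `U_m`. -/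
def qos (D : Scenario N M) (c : CSI) (W : Matrix (Fin N) (Fin M) ℂ) (m : Fin M) : ℝ :=
  match c with
  | .BF => sinr D W m (D.H.col m)
  | .RBF => ⨅ h : uncertainty D m, sinr D W m h

/-- Feasible set of the node relaxation: the rows in `B` are zero, no cardinality constraint. -/
def relaxFeasible (D : Scenario N M) (c : CSI) (B : Finset (Fin N)) :
    Set (Matrix (Fin N) (Fin M) ℂ) :=
  {W | (∀ m, D.γ m ≤ qos D c W m) ∧ ∀ n ∈ B, W n = 0}

/-- A node of the branch-and-bound tree: disjoint sets of activated and of shut-down antennas, of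
which there are at most `L` and at most `N - L`, respectively. -/
structure Node (N L : ℕ) where
  A : Finset (Fin N)
  B : Finset (Fin N)
  disjoint : Disjoint A B
  card_A : A.card ≤ L
  card_B : B.card + L ≤ N

/-- Feasible set of the problem at a node. (The rows of activated antennas are unrestricted.) -/
def nodeFeasible (D : Scenario N M) (c : CSI) (ν : Node N L) :
    Set (Matrix (Fin N) (Fin M) ℂ) :=
  {W | (∀ m, D.γ m ≤ qos D c W m) ∧ (∀ n ∈ ν.B, W n = 0) ∧ rowZero W ≤ L}

/-! ### The second-order cone program -/

/-- Variables `(W, t)` of the second-order cone program. -/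
abbrev SOCPVar (N M : ℕ) : Type := Matrix (Fin N) (Fin M) ℂ × ℝ

/-- `(W, t) ↦ Re (w_ℓᴴ h)`. -/
def gainRe (l : Fin M) (h : Fin N → ℂ) : SOCPVar N M →ₗ[ℝ] ℝ where
  toFun x := (gain x.1 l h).re
  map_add' x y := by simp [gain, dotProduct, Matrix.col, add_mul, Finset.sum_add_distrib]
  map_smul' r x := by
    simp [gain, dotProduct, Matrix.col, Finset.mul_sum, mul_assoc]

/-- `(W, t) ↦ Im (w_ℓᴴ h)`. -/
def gainIm (l : Fin M) (h : Fin N → ℂ) : SOCPVar N M →ₗ[ℝ] ℝ where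
  toFun x := (gain x.1 l h).im
  map_add' x y := by simp [gain, dotProduct, Matrix.col, add_mul, Finset.sum_add_distrib]
  map_smul' r x := by
    simp [gain, dotProduct, Matrix.col, Finset.mul_sum, mul_assoc, mul_add]

/-- `(W, t) ↦ Re W(n,m)`. -/
def entryRe (n : Fin N) (m : Fin M) : SOCPVar N M →ₗ[ℝ] ℝ where
  toFun x := (x.1 n m).re
  map_add' x y := by simp
  map_smul' r x := by simp

/-- `(W, t) ↦ Im W(n,m)`. -/
def entryIm (n : Fin N) (m : Fin M) : SOCPVar N M →ₗ[ℝ] ℝ where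
  toFun x := (x.1 n m).im
  map_add' x y := by simp
  map_smul' r x := by simp

/-- The cone constraint `‖(2 W, t - 1)‖₂ ≤ t + 1`, that is, `‖W‖_F² ≤ t`. -/
def epigraphCone (N M : ℕ) : SOCConstraint (SOCPVar N M) where
  Row := (Fin N × Fin M) ⊕ (Fin N × Fin M) ⊕ Unit
  A
    | .inl p => (2 : ℝ) • entryRe p.1 p.2
    | .inr (.inl p) => (2 : ℝ) • entryIm p.1 p.2
    | .inr (.inr _) => LinearMap.snd ℝ _ _
  b
    | .inl _ => 0
    | .inr (.inl _) => 0
    | .inr (.inr _) => -1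
  c := LinearMap.snd ℝ _ _
  d := 1

/-- The cone constraint
`√(∑_{ℓ ≠ m} |w_ℓᴴ h_m|² / σ_m² + 1) ≤ Re (w_mᴴ h_m) / √(γ_m σ_m²)`. -/
def sinrCone (D : Scenario N M) (m : Fin M) : SOCConstraint (SOCPVar N M) where
  Row := {l : Fin M // l ≠ m} ⊕ {l : Fin M // l ≠ m} ⊕ Unit
  A
    | .inl l => (D.σ m)⁻¹ • gainRe l.1 (D.H.col m)
    | .inr (.inl l) => (D.σ m)⁻¹ • gainIm l.1 (D.H.col m)
    | .inr (.inr _) => 0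
  b
    | .inl _ => 0
    | .inr (.inl _) => 0
    | .inr (.inr _) => 1
  c := (1 / √(D.γ m * D.σ m ^ 2)) • gainRe m (D.H.col m)
  d := 0

/-- The second-order cone program: minimize `t` subject to `‖W‖_F² ≤ t`, the SINR cone constraints
and `W(n,:) = 0` for `n ∈ B`. -/
def nodeSOCP (D : Scenario N M) (B : Finset (Fin N)) : SOCP (SOCPVar N M) where
  Cone := Option (Fin M)
  Eqn := (B × Fin M) ⊕ (B × Fin M)
  obj := LinearMap.snd ℝ _ _
  cone
    | none => epigraphCone N M
    | some m => sinrCone D m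
  F
    | .inl p => entryRe p.1.1 p.2
    | .inr p => entryIm p.1.1 p.2
  g _ := 0

/-- The perfect-CSI relaxation with excluded antennas `B` is solved optimally by the second-order
cone program: both have the same optimal value (`+∞` if infeasible), the program attains its
optimum whenever the relaxation is feasible, and the `W`-part of each of its optimal solutions is
an optimal solution of the relaxation. -/
def SolvedBySOCP (D : Scenario N M) (B : Finset (Fin N)) : Prop :=
  optValue power (relaxFeasible D .BF B) =
      optValue (nodeSOCP D B).obj (nodeSOCP D B).feasible ∧
  ((relaxFeasible D .BF B).Nonempty →
      ∃ x, IsOptimal (nodeSOCP D B).obj (nodeSOCP D B).feasible x) ∧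
  ∀ x, IsOptimal (nodeSOCP D B).obj (nodeSOCP D B).feasible x →
      IsOptimal power (relaxFeasible D .BF B) x.1

/-! ### The semidefinite relaxation -/

/-- `hᴴ X h` (a real number for Hermitian `X`). -/
def quad (X : Matrix (Fin N) (Fin N) ℂ) (h : Fin N → ℂ) : ℝ :=
  (star h ⬝ᵥ (X *ᵥ h)).re

/-- Worst-case SINR of user `m` for transmit covariances `X_1, …, X_M`. -/
def sdrQos (D : Scenario N M) (X : Fin M → Matrix (Fin N) (Fin N) ℂ) (m : Fin M) : ℝ :=
  ⨅ h : uncertainty D m,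
    quad (X m) h / (∑ j ∈ Finset.univ.erase m, quad (X j) h + D.σ m ^ 2)

/-- Objective of the semidefinite relaxation. -/
def sdrPower (X : Fin M → Matrix (Fin N) (Fin N) ℂ) : ℝ :=
  ∑ m, (X m).trace.re

/-- Feasible set of the semidefinite relaxation with excluded antennas `B`, obtained from the
imperfect-CSI node relaxation by replacing `w_m w_mᴴ` by an arbitrary positive semidefinite `X_m`.
(Since `X_m` is Hermitian, its columns in `B` vanish with the rows.) -/
def sdrFeasible (D : Scenario N M) (B : Finset (Fin N)) :
    Set (Fin M → Matrix (Fin N) (Fin N) ℂ) :=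
  {X | (∀ m, (X m).PosSemidef) ∧ (∀ m, D.γ m ≤ sdrQos D X m) ∧ ∀ m, ∀ n ∈ B, X m n = 0}

/-- The matrices `w_m w_mᴴ`. -/
def outer (W : Matrix (Fin N) (Fin M) ℂ) : Fin M → Matrix (Fin N) (Fin N) ℂ :=
  fun m => vecMulVec (W.col m) (star (W.col m))

/-- The imperfect-CSI relaxation with excluded antennas `B` is solved optimally by its semidefinite
relaxation: both have the same optimal value, the latter attains its optimum whenever the former is
feasible, and each optimal solution of the latter consists of matrices of rank one and factors as
`w_m w_mᴴ`, where every such factorization is an optimal solution of the former. -/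
def SolvedBySDR (D : Scenario N M) (B : Finset (Fin N)) : Prop :=
  optValue power (relaxFeasible D .RBF B) = optValue sdrPower (sdrFeasible D B) ∧
  ((relaxFeasible D .RBF B).Nonempty → ∃ X, IsOptimal sdrPower (sdrFeasible D B) X) ∧
  ∀ X, IsOptimal sdrPower (sdrFeasible D B) X →
      (∀ m, (X m).rank = 1) ∧
      (∃ W, outer W = X) ∧
      ∀ W, outer W = X → IsOptimal power (relaxFeasible D .RBF B) W

/-! ### The channel condition -/

/-- `H̃ = H(S,:)`. -/
def subChannel (D : Scenario N M) (S : Finset (Fin N)) : Matrix S (Fin M) ℂ :=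
  D.H.submatrix (fun n => n.1) id

/-- `H̃_{-m}`: column `m` removed. -/
def removeCol {ι : Type*} (H : Matrix ι (Fin M) ℂ) (m : Fin M) :
    Matrix ι {j : Fin M // j ≠ m} ℂ :=
  H.submatrix id (fun j => j.1)

/-- `Π_m = I - H̃_{-m} (H̃_{-m}ᴴ H̃_{-m})⁻¹ H̃_{-m}ᴴ`. -/
def complProj {ι : Type*} [Fintype ι] [DecidableEq ι] (H : Matrix ι (Fin M) ℂ) (m : Fin M) :
    Matrix ι ι ℂ :=
  1 - removeCol H m * ((removeCol H m)ᴴ * removeCol H m)⁻¹ * (removeCol H m)ᴴ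

/-- For every row subset with at least `L` rows and every user `m`, the inverse in `Π_m` exists and
`‖Π_m h̃_m‖² / ε_m² > 1 + M + (M - 1/M) γ_m`. -/
def ChannelCondition (D : Scenario N M) (L : ℕ) : Prop :=
  ∀ S : Finset (Fin N), L ≤ S.card → ∀ m : Fin M,
    IsUnit ((removeCol (subChannel D S) m)ᴴ * removeCol (subChannel D S) m).det ∧
    l2 (complProj (subChannel D S) m *ᵥ (subChannel D S).col m) ^ 2 / D.ε m ^ 2 >
      1 + (M : ℝ) + ((M : ℝ) - 1 / (M : ℝ)) * D.γ m

/-! ### The upper bound -/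

/-- `C` is a set of undecided antennas that together with `B` makes up `N - L` antennas, and no
other undecided antenna has less power in `W` than an antenna in `C`. -/
def IsLowestPower (ν : Node N L) (W : Matrix (Fin N) (Fin M) ℂ) (C : Finset (Fin N)) : Prop :=
  Disjoint C (ν.A ∪ ν.B) ∧ (C ∪ ν.B).card = N - L ∧
    ∀ i ∈ C, ∀ j, j ∉ C → j ∉ ν.A ∪ ν.B → l2 (W i) ^ 2 ≤ l2 (W j) ^ 2

/-- For each optimal solution `W` of the relaxation at the node, a choice of lowest-power undecided
antennas exists, and for each such choice the relaxation with the enlarged set of excluded antennas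
is solved by the method `Solved`, its optimal value is an upper bound of the optimal value of the
problem at the node, and its feasible points are feasible for the problem at the node. -/
def ValidUpperBound (D : Scenario N M) (c : CSI) (ν : Node N L)
    (Solved : Finset (Fin N) → Prop) : Prop :=
  ∀ W, IsOptimal power (relaxFeasible D c ν.B) W →
    (∃ C, IsLowestPower ν W C) ∧
    ∀ C, IsLowestPower ν W C →
      Solved (C ∪ ν.B) ∧
      optValue power (nodeFeasible D c ν) ≤ optValue power (relaxFeasible D c (C ∪ ν.B)) ∧
      relaxFeasible D c (C ∪ ν.B) ⊆ nodeFeasible D c ν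

end AntennaSelection

end

noncomputable section

namespace AntennaSelection

open Matrix
open scoped ComplexOrder

variable {N M L : ℕ}

/-! ### Optimal values -/

/-! Perfect CSI: multiplying a column of `W` by a phase changes neither the power nor any `‖gain‖`,
so each useful signal may be taken real and nonnegative (`exists_rotation`). The SINR constraints
then become second-order cones, and `Re z ≤ |z|` gives the converse. Optima exist because sublevel
sets are compact.

Imperfect CSI: it suffices that every optimal tuple of the semidefinite relaxation has rank one
(`solvedBySDR_of_rank`). Each channel in an uncertainty set gives one linear constraint on `X`, so a
multiplier is a positive measure on the uncertainty set of each user. Only its second moment `S_m`,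
first moment and mass `c_m` matter. Zero-forcing beamformers give a Slater point
(`exists_strictly_feasible`), and Sion's minimax theorem then yields multipliers with complementary
slackness (`exists_lagrange_multiplier`, `exists_sdr_multiplier`).

Complementary slackness forces `xᴴ S_m x ≥ γ_m ‖x‖²` on the range of `X_m`. If the rank were at
least two, some nonzero `x` in the range would be orthogonal to the barycenter `b` of the measure.
The variance of a measure on a ball of radius `ε_m` about `h_m` is at most `c_m (ε_m² - ‖b -
h_m‖²)`, so this number would be at least `γ_m` (`exists_barycenter`). Testing dual feasibility on
the zero-forcing directions bounds each `t_j = ε_j² c_j` in terms of the others. The extra `γ_m`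
makes the bound for user `m` so strong that the bounds together are contradictory
(`not_forall_multiplier_bounds`). This is where the channel condition enters.

Upper bound: once `N - L` antennas are excluded, at most `L` rows can be nonzero, so the cardinality
constraint holds automatically and the relaxation results apply to the enlarged set. -/

lemma optValue_le_optValue {X Y : Type*} {f : X → ℝ} {g : Y → ℝ} {S : Set X} {T : Set Y}
    (h : ∀ y ∈ T, ∃ x ∈ S, f x ≤ g y) : optValue f S ≤ optValue g T := by
  refine le_iInf₂ fun y hy => ?_
  obtain ⟨x, hx, hxy⟩ := h y hy
  exact iInf₂_le_of_le x hx (EReal.coe_le_coe_iff.2 hxy)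

/-! ### The second-order cone program -/

lemma power_nonneg (W : Matrix (Fin N) (Fin M) ℂ) : 0 ≤ power W :=
  Finset.sum_nonneg fun _ _ => Finset.sum_nonneg fun _ _ => sq_nonneg _

lemma complex_norm_sq (z : ℂ) : ‖z‖ ^ 2 = z.re ^ 2 + z.im ^ 2 := by
  rw [Complex.sq_norm, Complex.normSq_apply]; ring

lemma entryRe_apply (n : Fin N) (m : Fin M) (x : SOCPVar N M) :
    entryRe n m x = (x.1 n m).re := rfl

lemma entryIm_apply (n : Fin N) (m : Fin M) (x : SOCPVar N M) :
    entryIm n m x = (x.1 n m).im := rfl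

lemma epigraphCone_holds_iff (x : SOCPVar N M) :
    (epigraphCone N M).Holds x ↔ power x.1 ≤ x.2 := by
  have hs : ∑ k, ((epigraphCone N M).A k x + (epigraphCone N M).b k) ^ 2 =
      4 * power x.1 + (x.2 - 1) ^ 2 := by
    change ∑ k : (Fin N × Fin M) ⊕ (Fin N × Fin M) ⊕ Unit, _ = _
    rw [Fintype.sum_sum_type, Fintype.sum_sum_type]
    simp only [epigraphCone, power, complex_norm_sq]
    simp only [LinearMap.smul_apply, entryRe_apply, entryIm_apply, smul_eq_mul, add_zero,
      LinearMap.snd_apply, Finset.univ_unique, Finset.sum_singleton, Fintype.sum_prod_type,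
      mul_pow, Finset.sum_add_distrib, ← Finset.mul_sum]
    ring
  have hc : (epigraphCone N M).c x + (epigraphCone N M).d = x.2 + 1 := rfl
  rw [SOCConstraint.Holds, hs, hc, Real.sqrt_le_iff]
  have := power_nonneg x.1
  constructor
  · rintro ⟨-, h⟩; nlinarith
  · intro h; exact ⟨by linarith, by nlinarith⟩

lemma sinrCone_holds_iff (D : Scenario N M) {m : Fin M} (hσ : 0 < D.σ m) (hγ : 0 < D.γ m)
    (x : SOCPVar N M) :
    (sinrCone D m).Holds x ↔ 0 ≤ (gain x.1 m (D.H.col m)).re ∧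
      D.γ m * (∑ l ∈ Finset.univ.erase m, ‖gain x.1 l (D.H.col m)‖ ^ 2 + D.σ m ^ 2) ≤
        (gain x.1 m (D.H.col m)).re ^ 2 := by
  have hs : ∑ k, ((sinrCone D m).A k x + (sinrCone D m).b k) ^ 2 =
      (D.σ m ^ 2)⁻¹ * (∑ l ∈ Finset.univ.erase m, ‖gain x.1 l (D.H.col m)‖ ^ 2) + 1 := by
    change ∑ k : {l : Fin M // l ≠ m} ⊕ {l : Fin M // l ≠ m} ⊕ Unit, _ = _
    rw [Fintype.sum_sum_type, Fintype.sum_sum_type,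
      Finset.sum_subtype (p := fun l => l ≠ m) (Finset.univ.erase m) (by simp)]
    simp only [sinrCone, gainRe, gainIm, complex_norm_sq]
    simp only [LinearMap.smul_apply, LinearMap.coe_mk, AddHom.coe_mk, smul_eq_mul, add_zero,
      LinearMap.zero_apply, zero_add, one_pow, Finset.univ_unique, Finset.sum_singleton,
      mul_pow, Finset.sum_add_distrib, ← Finset.mul_sum]
    ring
  have hc : (sinrCone D m).c x + (sinrCone D m).d =
      1 / √(D.γ m * D.σ m ^ 2) * (gain x.1 m (D.H.col m)).re := by
    simp [sinrCone, gainRe]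
  have hpos : 0 < D.γ m * D.σ m ^ 2 := by positivity
  have hr : 0 < √(D.γ m * D.σ m ^ 2) := Real.sqrt_pos.2 hpos
  rw [SOCConstraint.Holds, hs, hc, Real.sqrt_le_iff, mul_pow, div_pow, Real.sq_sqrt hpos.le,
    one_pow]
  refine and_congr ?_ ?_
  · rw [mul_nonneg_iff_of_pos_left (by positivity)]
  · generalize ∑ l ∈ Finset.univ.erase m, ‖gain x.1 l (D.H.col m)‖ ^ 2 = s
    generalize (gain x.1 m (D.H.col m)).re ^ 2 = r
    rw [one_div_mul_eq_div, le_div_iff₀ hpos]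
    have : ((D.σ m ^ 2)⁻¹ * s + 1) * (D.γ m * D.σ m ^ 2) = D.γ m * (s + D.σ m ^ 2) := by
      field_simp
    rw [this]

lemma nodeSOCP_eqns_iff (D : Scenario N M) (B : Finset (Fin N)) (x : SOCPVar N M) :
    (∀ j, (nodeSOCP D B).F j x = (nodeSOCP D B).g j) ↔ ∀ n ∈ B, x.1 n = 0 := by
  constructor
  · intro h n hn
    funext m
    exact Complex.ext (h (.inl (⟨n, hn⟩, m))) (h (.inr (⟨n, hn⟩, m)))
  · rintro h (⟨⟨n, hn⟩, m⟩ | ⟨⟨n, hn⟩, m⟩) <;>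
      simp [nodeSOCP, entryRe_apply, entryIm_apply, h n hn]

lemma mem_nodeSOCP_feasible_iff (D : Scenario N M) (hσ : ∀ m, 0 < D.σ m) (hγ : ∀ m, 0 < D.γ m)
    (B : Finset (Fin N)) (x : SOCPVar N M) :
    x ∈ (nodeSOCP D B).feasible ↔ power x.1 ≤ x.2 ∧
      (∀ m, 0 ≤ (gain x.1 m (D.H.col m)).re ∧
        D.γ m * (∑ l ∈ Finset.univ.erase m, ‖gain x.1 l (D.H.col m)‖ ^ 2 + D.σ m ^ 2) ≤
          (gain x.1 m (D.H.col m)).re ^ 2) ∧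
      ∀ n ∈ B, x.1 n = 0 := by
  have h1 : (∀ i, ((nodeSOCP D B).cone i).Holds x) ↔
      (epigraphCone N M).Holds x ∧ ∀ m, (sinrCone D m).Holds x :=
    Option.forall
  rw [SOCP.feasible, Set.mem_ofPred_eq, h1, nodeSOCP_eqns_iff, epigraphCone_holds_iff, and_assoc]
  simp only [fun m => sinrCone_holds_iff D (hσ m) (hγ m) x]

lemma le_sinr_iff (D : Scenario N M) {m : Fin M} (hσ : 0 < D.σ m)
    (W : Matrix (Fin N) (Fin M) ℂ) (h : Fin N → ℂ) (c : ℝ) :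
    c ≤ sinr D W m h ↔
      c * (∑ l ∈ Finset.univ.erase m, ‖gain W l h‖ ^ 2 + D.σ m ^ 2) ≤ ‖gain W m h‖ ^ 2 := by
  have : 0 < ∑ l ∈ Finset.univ.erase m, ‖gain W l h‖ ^ 2 + D.σ m ^ 2 :=
    add_pos_of_nonneg_of_pos (Finset.sum_nonneg fun _ _ => sq_nonneg _) (by positivity)
  rw [sinr, le_div_iff₀ this]

/-- The cone bounds `(Re z)²` from below, hence also `|z|²`, where `z` is the useful signal. -/
lemma relaxFeasible_of_nodeSOCP_feasible (D : Scenario N M) (hσ : ∀ m, 0 < D.σ m)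
    (hγ : ∀ m, 0 < D.γ m) (B : Finset (Fin N)) {x : SOCPVar N M}
    (hx : x ∈ (nodeSOCP D B).feasible) : x.1 ∈ relaxFeasible D .BF B ∧ power x.1 ≤ x.2 := by
  obtain ⟨h1, h2, h3⟩ := (mem_nodeSOCP_feasible_iff D hσ hγ B x).1 hx
  refine ⟨⟨fun m => (le_sinr_iff D (hσ m) _ _ _).2 ((h2 m).2.trans ?_), h3⟩, h1⟩
  rw [complex_norm_sq]
  nlinarith [sq_nonneg (gain x.1 m (D.H.col m)).im]

/-- Multiplication of column `m` by the phase that makes its useful signal real and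
nonnegative. -/
lemma exists_rotation (D : Scenario N M) (W : Matrix (Fin N) (Fin M) ℂ) :
    ∃ W' : Matrix (Fin N) (Fin M) ℂ, (∀ n m, ‖W' n m‖ = ‖W n m‖) ∧
      (∀ l h, ‖gain W' l h‖ = ‖gain W l h‖) ∧
      ∀ m, (gain W' m (D.H.col m)).re = ‖gain W m (D.H.col m)‖ := by
  have hθ : ∀ z : ℂ, ∃ θ : ℂ, ‖θ‖ = 1 ∧ star θ * z = (‖z‖ : ℂ) := fun z => by
    by_cases hz : z = 0
    · exact ⟨1, by simp, by simp [hz]⟩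
    · have hz' : ((‖z‖ : ℝ) : ℂ) ≠ 0 := by simpa using hz
      refine ⟨z / ‖z‖, by simp [hz], ?_⟩
      have : star z * z = (‖z‖ : ℂ) ^ 2 := by
        simpa using Complex.conj_mul' z
      rw [star_div₀, div_mul_eq_mul_div, this]
      simp only [Complex.star_def, Complex.conj_ofReal]
      field_simp
  choose θ hθ1 hθ2 using hθ
  let t : Fin M → ℂ := fun m => θ (gain W m (D.H.col m))
  have hg : ∀ l h, gain (Matrix.of fun n m => t m * W n m) l h = star (t l) * gain W l h := by
    intro l h
    simp [gain, dotProduct, Matrix.col, Finset.mul_sum, mul_assoc]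
  refine ⟨Matrix.of fun n m => t m * W n m, fun n m => ?_, fun l h => ?_, fun m => ?_⟩
  · simp [t, hθ1]
  · rw [hg, norm_mul, norm_star, hθ1, one_mul]
  · rw [hg, hθ2, Complex.ofReal_re]

lemma exists_nodeSOCP_feasible (D : Scenario N M) (hσ : ∀ m, 0 < D.σ m)
    (hγ : ∀ m, 0 < D.γ m) (B : Finset (Fin N)) {W : Matrix (Fin N) (Fin M) ℂ}
    (hW : W ∈ relaxFeasible D .BF B) :
    ∃ x ∈ (nodeSOCP D B).feasible, (nodeSOCP D B).obj x = power W := by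
  obtain ⟨W', h1, h2, h3⟩ := exists_rotation D W
  have hp : power W' = power W := by simp only [power, h1]
  refine ⟨(W', power W), (mem_nodeSOCP_feasible_iff D hσ hγ B _).2 ⟨hp.le, fun m => ?_, ?_⟩, rfl⟩
  · simp only [h2, h3]
    exact ⟨norm_nonneg _, (le_sinr_iff D (hσ m) _ _ _).1 (hW.1 m)⟩
  · intro n hn
    funext m
    have := h1 n m
    rw [hW.2 n hn] at this
    simpa using this

/-! ### Attainment for the cone program -/

lemma norm_entry_sq_le_power (W : Matrix (Fin N) (Fin M) ℂ) (n : Fin N) (m : Fin M) :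
    ‖W n m‖ ^ 2 ≤ power W :=
  (Finset.single_le_sum (f := fun m => ‖W n m‖ ^ 2) (fun _ _ => sq_nonneg _)
    (Finset.mem_univ m)).trans
  (Finset.single_le_sum (f := fun n => ∑ m, ‖W n m‖ ^ 2)
    (fun _ _ => Finset.sum_nonneg fun _ _ => sq_nonneg _) (Finset.mem_univ n))

lemma isCompact_power_le (r : ℝ) :
    IsCompact {x : SOCPVar N M | power x.1 ≤ x.2 ∧ x.2 ≤ r} := by
  have hK : IsCompact ((Set.univ.pi fun _ : Fin N => Set.univ.pi fun _ : Fin M =>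
      Metric.closedBall (0 : ℂ) √r) ×ˢ Set.Icc (0 : ℝ) r) :=
    (isCompact_univ_pi fun _ => isCompact_univ_pi fun _ => isCompact_closedBall _ _).prod
      isCompact_Icc
  refine hK.of_isClosed_subset ?_ ?_
  · refine IsClosed.and (isClosed_le ?_ continuous_snd) (isClosed_le continuous_snd (by fun_prop))
    unfold power
    fun_prop
  · rintro ⟨W, t⟩ ⟨h1, h2⟩
    refine ⟨fun n _ m _ => ?_, (power_nonneg W).trans h1, h2⟩
    rw [mem_closedBall_zero_iff]
    exact Real.le_sqrt_of_sq_le ((norm_entry_sq_le_power W n m).trans (h1.trans h2))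

lemma isClosed_nodeSOCP_feasible (D : Scenario N M) (B : Finset (Fin N)) :
    IsClosed (nodeSOCP D B).feasible := by
  have hc : ∀ f : SOCPVar N M →ₗ[ℝ] ℝ, Continuous f := fun f => f.continuous_of_finiteDimensional
  have h : (nodeSOCP D B).feasible = (⋂ i, {x | ((nodeSOCP D B).cone i).Holds x}) ∩
      ⋂ j, {x | (nodeSOCP D B).F j x = (nodeSOCP D B).g j} := by
    ext x; simp [SOCP.feasible]
  rw [h]
  refine (isClosed_iInter fun i => isClosed_le ?_ ((hc _).add continuous_const)).inter
    (isClosed_iInter fun j => isClosed_eq (hc _) continuous_const)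
  exact Real.continuous_sqrt.comp
    (continuous_finsetSum _ fun k _ => ((hc _).add continuous_const).pow 2)

theorem solvedBySOCP (D : Scenario N M) (hσ : ∀ m, 0 < D.σ m) (hγ : ∀ m, 0 < D.γ m)
    (B : Finset (Fin N)) : SolvedBySOCP D B := by
  refine ⟨le_antisymm ?_ ?_, ?_, ?_⟩
  · exact optValue_le_optValue fun x hx =>
      ⟨x.1, relaxFeasible_of_nodeSOCP_feasible D hσ hγ B hx⟩
  · exact optValue_le_optValue fun W hW =>
      (exists_nodeSOCP_feasible D hσ hγ B hW).imp fun x hx => ⟨hx.1, hx.2.le⟩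
  · rintro ⟨W, hW⟩
    obtain ⟨x₀, hx₀, -⟩ := exists_nodeSOCP_feasible D hσ hγ B hW
    have hK := (isCompact_power_le (N := N) (M := M) x₀.2).inter_right
      (isClosed_nodeSOCP_feasible D B)
    obtain ⟨x, hx, hmin⟩ := hK.exists_isMinOn (f := (nodeSOCP D B).obj)
      ⟨x₀, ⟨(relaxFeasible_of_nodeSOCP_feasible D hσ hγ B hx₀).2, le_rfl⟩, hx₀⟩
      continuous_snd.continuousOn
    refine ⟨x, hx.2, fun y hy => ?_⟩
    -- Points outside the compact sublevel set are already worse than `x₀`.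
    by_cases hyt : y.2 ≤ x₀.2
    · exact hmin ⟨⟨(relaxFeasible_of_nodeSOCP_feasible D hσ hγ B hy).2, hyt⟩, hy⟩
    · exact hx.1.2.trans (not_le.1 hyt).le
  · rintro x ⟨hx, hmin⟩
    obtain ⟨hW, hp⟩ := relaxFeasible_of_nodeSOCP_feasible D hσ hγ B hx
    refine ⟨hW, fun W' hW' => ?_⟩
    obtain ⟨y, hy, hyW⟩ := exists_nodeSOCP_feasible D hσ hγ B hW'
    exact hp.trans ((hmin hy).trans hyW.le)

/-! ### Shutting down the antennas of lowest power -/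

/-- Greedy choice: adjoin a minimizer of `f` on what remains. It lies below everything still left
out, and the earlier choices keep that property. -/
lemma exists_lowest_subset {ι α : Type*} [DecidableEq ι] [LinearOrder α] (f : ι → α)
    (U : Finset ι) {k : ℕ} (hk : k ≤ U.card) :
    ∃ C ⊆ U, C.card = k ∧ ∀ i ∈ C, ∀ j ∈ U, j ∉ C → f i ≤ f j := by
  induction k with
  | zero => exact ⟨∅, by simp⟩
  | succ k ih =>
    obtain ⟨C, hCU, hC, hle⟩ := ih (by omega)
    have hne : (U \ C).Nonempty := by
      rw [← Finset.card_pos, Finset.card_sdiff_of_subset hCU]; omega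
    obtain ⟨a, ha, hmin⟩ := Finset.exists_min_image (U \ C) f hne
    rw [Finset.mem_sdiff] at ha
    refine ⟨insert a C, Finset.insert_subset ha.1 hCU, ?_, ?_⟩
    · rw [Finset.card_insert_of_notMem ha.2, hC]
    · intro i hi j hj hjC
      rw [Finset.mem_insert, not_or] at hjC
      rcases Finset.mem_insert.1 hi with rfl | hi
      · exact hmin j (Finset.mem_sdiff.2 ⟨hj, hjC.2⟩)
      · exact hle i hi j hj hjC.2

lemma exists_isLowestPower (ν : Node N L) (W : Matrix (Fin N) (Fin M) ℂ) :
    ∃ C, IsLowestPower ν W C := by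
  -- There are `N - |A| - |B|` undecided antennas, and `|A| ≤ L`. By `ν.card_B` the truncated
  -- subtraction is exact.
  have hU : N - L - ν.B.card ≤ ((ν.A ∪ ν.B)ᶜ).card := by
    rw [Finset.card_compl, Fintype.card_fin, Finset.card_union_of_disjoint ν.disjoint]
    have := ν.card_A
    omega
  obtain ⟨C, hCU, hC, hle⟩ := exists_lowest_subset (fun i => l2 (W i) ^ 2) _ hU
  have hd : Disjoint C (ν.A ∪ ν.B) := Finset.disjoint_left.2 fun i hi hi' =>
    Finset.mem_compl.1 (hCU hi) hi'
  refine ⟨C, hd, ?_, fun i hi j hj hj' => hle i hi j (Finset.mem_compl.2 hj') hj⟩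
  rw [Finset.card_union_of_disjoint (hd.mono_right Finset.subset_union_right), hC]
  have := ν.card_B
  omega

lemma relaxFeasible_subset_nodeFeasible (D : Scenario N M) (c : CSI) (ν : Node N L)
    {C : Finset (Fin N)} (hC : (C ∪ ν.B).card = N - L) :
    relaxFeasible D c (C ∪ ν.B) ⊆ nodeFeasible D c ν := by
  rintro W ⟨h1, h2⟩
  refine ⟨h1, fun n hn => h2 n (Finset.mem_union_right _ hn), ?_⟩
  have hsub : {n | W n ≠ 0} ⊆ ((C ∪ ν.B)ᶜ : Finset (Fin N)) := fun n hn =>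
    Finset.mem_coe.2 (Finset.mem_compl.2 fun hn' => hn (h2 n hn'))
  refine (Set.ncard_le_ncard hsub (Finset.finite_toSet _)).trans ?_
  rw [Set.ncard_coe_finset, Finset.card_compl, Fintype.card_fin, hC]
  have := ν.card_B
  omega

theorem validUpperBound (D : Scenario N M) (c : CSI) (ν : Node N L)
    {Solved : Finset (Fin N) → Prop} (hS : ∀ B : Finset (Fin N), B.card + L ≤ N → Solved B) :
    ValidUpperBound D c ν Solved := by
  refine fun W _ => ⟨exists_isLowestPower ν W, fun C hC => ⟨hS _ ?_, ?_, ?_⟩⟩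
  · have := hC.2.1
    have := ν.card_B
    omega
  · exact optValue_le_optValue fun W hW =>
      ⟨W, relaxFeasible_subset_nodeFeasible D c ν hC.2.1 hW, le_rfl⟩
  · exact relaxFeasible_subset_nodeFeasible D c ν hC.2.1

/-! ### Lagrange duality -/

open scoped Pointwise in
/-- Strong duality with attained dual for a conic program with linear constraints `s g ≤ b x g`,
`g ∈ G`, that has a strictly feasible point: a multiplier `y` in the closed convex cone generated
by `G` exists. -/
theorem exists_lagrange_multiplier {E F : Type*} [NormedAddCommGroup E] [NormedSpace ℝ E]
    [FiniteDimensional ℝ E] [NormedAddCommGroup F] [NormedSpace ℝ F] [FiniteDimensional ℝ F]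
    {K : Set E} (hK : Convex ℝ K) (hcone : ∀ x ∈ K, ∀ t : ℝ, 0 ≤ t → t • x ∈ K)
    (hadd : ∀ x ∈ K, ∀ y ∈ K, x + y ∈ K)
    (p : E →ₗ[ℝ] ℝ) (hp : ∀ x ∈ K, 0 ≤ p x) (hcomp : ∀ r, IsCompact {x ∈ K | p x ≤ r})
    (b : E →ₗ[ℝ] F →ₗ[ℝ] ℝ) (s : F →ₗ[ℝ] ℝ) {G : Set F} (hG : Bornology.IsBounded G)
    {x : E} (hx : x ∈ K) (hxG : ∀ g ∈ G, s g ≤ b x g)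
    (hmin : ∀ z ∈ K, (∀ g ∈ G, s g ≤ b z g) → p x ≤ p z)
    {x₀ : E} (hx₀ : x₀ ∈ K) (hx₀G : ∀ g ∈ G, s g + 1 ≤ b x₀ g) :
    ∃ y : F, (∀ φ : F →ₗ[ℝ] ℝ, (∀ g ∈ G, 0 ≤ φ g) → 0 ≤ φ y) ∧
      (∀ z ∈ K, b z y ≤ p z) ∧ p x = b x y := by
  -- `R` is an exact penalty weight: multipliers are confined to the compact set `Y`, and `R` is
  -- large enough that this costs nothing. The choice is used in `h4`.
  set R : ℝ := |p x₀| + |p x| + 1 with hR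
  have hRpos : 0 < R := by positivity
  set Y : Set F := closure (convexHull ℝ (insert 0 (R • G))) with hY
  have hYcomp : IsCompact Y := by
    refine Metric.isCompact_of_isClosed_isBounded isClosed_closure ?_
    exact (isBounded_convexHull.2 ((hG.smul₀ R).insert 0)).closure
  have hYconv : Convex ℝ Y := (convex_convexHull ℝ _).closure
  have hYsub : insert 0 (R • G) ⊆ Y := (subset_convexHull ℝ _).trans subset_closure
  have hYφ : ∀ y ∈ Y, ∀ φ : F →ₗ[ℝ] ℝ, (∀ g ∈ G, 0 ≤ φ g) → 0 ≤ φ y := by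
    intro y hy φ hφ
    have hcl : IsClosed {y | 0 ≤ φ y} :=
      isClosed_le continuous_const φ.continuous_of_finiteDimensional
    refine closure_minimal (convexHull_min ?_ (convex_halfSpace_ge φ.isLinear 0)) hcl hy
    rintro _ (rfl | ⟨g, hg, rfl⟩)
    · simp
    · simpa using mul_nonneg hRpos.le (hφ g hg)
  -- The slack `+ 1` leaves room to move from `x` in every direction of `K`, which `hpos` needs.
  set X : Set E := {z ∈ K | p z ≤ p x + 1} with hX
  have hXconv : Convex ℝ X := hK.inter (convex_halfSpace_le p.isLinear _)
  have hxX : x ∈ X := ⟨hx, by linarith⟩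
  set f : E → F → ℝ := fun z y => p z - (b z y - s y) with hf
  obtain ⟨a, ha, y, hy, hsad⟩ := Sion.exists_isSaddlePointOn (f := f) ⟨x, hxX⟩ hXconv (hcomp _)
    (fun y _ => by
      have : Continuous fun z => f z y :=
        p.continuous_of_finiteDimensional.sub
          ((b.flip y).continuous_of_finiteDimensional.sub continuous_const)
      exact this.lowerSemicontinuous.lowerSemicontinuousOn X)
    (fun y _ => by
      refine ConvexOn.quasiconvexOn ⟨hXconv, fun z _ w _ t u _ _ htu => le_of_eq ?_⟩
      simp only [hf, map_add, map_smul, LinearMap.add_apply, LinearMap.smul_apply, smul_eq_mul]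
      linear_combination -s y * htu)
    hYconv ⟨0, hYsub (Set.mem_insert _ _)⟩ hYcomp
    (fun z _ => by
      have : Continuous fun y => f z y :=
        continuous_const.sub
          ((b z).continuous_of_finiteDimensional.sub s.continuous_of_finiteDimensional)
      exact this.upperSemicontinuous.upperSemicontinuousOn Y)
    (fun z _ => by
      refine ConcaveOn.quasiconcaveOn ⟨hYconv, fun y _ w _ t u _ _ htu => le_of_eq ?_⟩
      simp only [hf, map_add, map_smul, smul_eq_mul]
      linear_combination (p z) * htu)
  have hfx : f x y ≤ p x := by
    have := hYφ y hy (b x - s) (fun g hg => by simpa using hxG g hg)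
    simp only [LinearMap.sub_apply] at this
    simp only [hf]; linarith
  have hpa : p a ≤ p x := by
    have := hsad x hxX 0 (hYsub (Set.mem_insert _ _))
    simp only [hf, map_zero, sub_zero] at this hfx
    linarith
  -- The saddle point `a` violates each constraint by at most `δ = (p x - p a) / R`. Mixing in `δ •
  -- x₀`, whose margin is 1, and rescaling repairs this. Optimality of `x` against the repaired
  -- point forces `δ ≤ 0`.
  have hpa' : p x ≤ p a := by
    set δ : ℝ := (p x - p a) / R with hδ
    have hδ0 : 0 ≤ δ := div_nonneg (by linarith) hRpos.le
    have hδR : R * δ = p x - p a := by rw [hδ]; field_simp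
    have hviol : ∀ g ∈ G, s g - δ ≤ b a g := by
      intro g hg
      have := hsad x hxX (R • g) (hYsub (Set.mem_insert_of_mem _ (Set.smul_mem_smul_set hg)))
      simp only [hf, map_smul, smul_eq_mul] at this hfx
      have h2 : R * (s g - b a g) ≤ R * δ := by rw [hδR]; nlinarith
      have := le_of_mul_le_mul_left h2 hRpos
      linarith
    have hfeas := hmin ((1 + δ)⁻¹ • (a + δ • x₀))
      (hcone _ (hadd _ ha.1 _ (hcone _ hx₀ δ hδ0)) _ (by positivity))
      (fun g hg => by
        simp only [map_add, map_smul, LinearMap.add_apply, LinearMap.smul_apply, smul_eq_mul]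
        rw [le_inv_mul_iff₀ (by positivity)]
        nlinarith [hviol g hg, mul_le_mul_of_nonneg_left (hx₀G g hg) hδ0])
    simp only [map_add, map_smul, smul_eq_mul] at hfeas
    rw [le_inv_mul_iff₀ (by positivity)] at hfeas
    have h3 : δ * (p x + R - p x₀) ≤ 0 := by nlinarith
    have h4 : 1 ≤ p x + R - p x₀ := by
      rw [hR]; linarith [neg_abs_le (p x), le_abs_self (p x₀)]
    have h5 : δ ≤ 0 := by nlinarith
    nlinarith
  have hlow : ∀ z ∈ X, p x ≤ f z y := by
    intro z hz
    have := hsad z hz 0 (hYsub (Set.mem_insert _ _))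
    simp only [hf, map_zero, sub_zero] at this
    simp only [hf]; linarith
  have hsy : f x y = p x := le_antisymm hfx (hlow x hxX)
  have hpos : ∀ z ∈ K, b z y ≤ p z := by
    intro z hz
    set t : ℝ := (|p z| + 1)⁻¹ with ht
    have htpos : 0 < t := by positivity
    have hmem : x + t • z ∈ X := by
      refine ⟨hadd _ hx _ (hcone _ hz _ htpos.le), ?_⟩
      have : t * p z ≤ 1 := by
        rw [ht, inv_mul_le_iff₀ (by positivity)]
        linarith [le_abs_self (p z)]
      simpa using this
    have := hlow _ hmem
    simp only [hf, map_add, map_smul, LinearMap.add_apply, LinearMap.smul_apply, smul_eq_mul]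
      at this hsy
    have h6 : t * b z y ≤ t * p z := by linarith
    exact le_of_mul_le_mul_left h6 htpos
  refine ⟨y, hYφ y hy, hpos, le_antisymm ?_ (hpos x hx)⟩
  -- At `z = 0` the Lagrangian equals `s y`, so `p x ≤ s y`, while `f x y = p x` says `s y = b x y`.
  have hzero : (0 : E) ∈ X := by
    refine ⟨by simpa using hcone x hx 0 le_rfl, ?_⟩
    rw [map_zero]
    linarith [hp x hx]
  have := hlow 0 hzero
  simp only [hf, map_zero, LinearMap.zero_apply] at this hsy
  linarith

/-! ### Hermitian forms -/

lemma l2_sq {ι : Type*} [Fintype ι] (x : ι → ℂ) : l2 x ^ 2 = ∑ i, ‖x i‖ ^ 2 := by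
  rw [l2, EuclideanSpace.norm_sq_eq]

lemma star_dotProduct_self {ι : Type*} [Fintype ι] (x : ι → ℂ) :
    star x ⬝ᵥ x = ((l2 x ^ 2 : ℝ) : ℂ) := by
  rw [l2_sq, dotProduct]
  push_cast
  exact Finset.sum_congr rfl fun i _ => Complex.conj_mul' (x i)

lemma l2_pos {ι : Type*} [Fintype ι] {x : ι → ℂ} (hx : x ≠ 0) : 0 < l2 x := by
  simpa [l2] using hx

lemma norm_star_dotProduct_le {ι : Type*} [Fintype ι] (x y : ι → ℂ) :
    ‖star x ⬝ᵥ y‖ ≤ l2 x * l2 y := by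
  have := norm_inner_le_norm (𝕜 := ℂ) (WithLp.toLp 2 x : EuclideanSpace ℂ ι) (WithLp.toLp 2 y)
  rwa [EuclideanSpace.inner_toLp_toLp, dotProduct_comm] at this

lemma norm_star_dotProduct_sq_le {ι : Type*} [Fintype ι] (x y : ι → ℂ) :
    ‖star x ⬝ᵥ y‖ ^ 2 ≤ l2 x ^ 2 * l2 y ^ 2 := by
  rw [← mul_pow]
  exact pow_le_pow_left₀ (norm_nonneg _) (norm_star_dotProduct_le x y) 2

lemma norm_star_dotProduct_comm {ι : Type*} [Fintype ι] (x y : ι → ℂ) :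
    ‖star x ⬝ᵥ y‖ = ‖star y ⬝ᵥ x‖ := by
  rw [star_dotProduct, norm_star]

lemma quad_vecMulVec (w h : Fin N → ℂ) :
    quad (vecMulVec w (star w)) h = ‖star w ⬝ᵥ h‖ ^ 2 := by
  rw [quad, vecMulVec_mulVec]
  have : star h ⬝ᵥ (MulOpposite.op (star w ⬝ᵥ h) • w) = star (star w ⬝ᵥ h) * (star w ⬝ᵥ h) := by
    rw [dotProduct_smul, MulOpposite.smul_eq_mul_unop, MulOpposite.unop_op, star_dotProduct h w]
  rw [this, Complex.star_def, Complex.conj_mul']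
  norm_cast

lemma trace_vecMulVec_star (w : Fin N → ℂ) : (vecMulVec w (star w)).trace.re = l2 w ^ 2 := by
  rw [trace_vecMulVec, dotProduct_comm, star_dotProduct_self, Complex.ofReal_re]

/-- The real trace form `Re Tr (S X)`. -/
def trForm (S : Matrix (Fin N) (Fin N) ℂ) : Matrix (Fin N) (Fin N) ℂ →ₗ[ℝ] ℝ where
  toFun X := (S * X).trace.re
  map_add' X Y := by simp [mul_add]
  map_smul' r X := by simp

lemma trForm_apply (S X : Matrix (Fin N) (Fin N) ℂ) : trForm S X = (S * X).trace.re := rfl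

lemma trForm_comm (S X : Matrix (Fin N) (Fin N) ℂ) : trForm S X = trForm X S := by
  rw [trForm_apply, trForm_apply, trace_mul_comm]

lemma trForm_one (X : Matrix (Fin N) (Fin N) ℂ) : trForm 1 X = X.trace.re := by
  rw [trForm_apply, one_mul]

lemma trForm_vecMulVec (S : Matrix (Fin N) (Fin N) ℂ) (x : Fin N → ℂ) :
    trForm S (vecMulVec x (star x)) = quad S x := by
  rw [trForm_apply, quad, mul_vecMulVec, trace_vecMulVec, dotProduct_comm]

lemma posSemidef_iff_quad {X : Matrix (Fin N) (Fin N) ℂ} :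
    X.PosSemidef ↔ X.IsHermitian ∧ ∀ x, 0 ≤ quad X x := by
  rw [posSemidef_iff_dotProduct_mulVec]
  refine and_congr_right fun hX => forall_congr' fun x => ?_
  have : (star x ⬝ᵥ (X *ᵥ x)).im = 0 := hX.im_star_dotProduct_mulVec_self x
  rw [Complex.le_def, quad]
  simp [this]

lemma quad_nonneg {X : Matrix (Fin N) (Fin N) ℂ} (hX : X.PosSemidef) (x : Fin N → ℂ) :
    0 ≤ quad X x := (posSemidef_iff_quad.1 hX).2 x

lemma quad_sub_smul (X Y : Matrix (Fin N) (Fin N) ℂ) (t : ℝ) (x : Fin N → ℂ) :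
    quad (X - t • Y) x = quad X x - t * quad Y x := by
  simp only [← trForm_vecMulVec, trForm_comm _ (vecMulVec x (star x)), map_sub, map_smul,
    smul_eq_mul]

/-- The Cauchy–Schwarz inequality for a positive semidefinite form. -/
lemma norm_form_sq_le {X : Matrix (Fin N) (Fin N) ℂ} (hX : X.PosSemidef) (y z : Fin N → ℂ) :
    ‖star y ⬝ᵥ (X *ᵥ z)‖ ^ 2 ≤ quad X y * quad X z := by
  obtain ⟨B, rfl⟩ : ∃ B : Matrix (Fin N) (Fin N) ℂ, X = Bᴴ * B := by
    open scoped MatrixOrder in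
    exact CStarAlgebra.nonneg_iff_eq_star_mul_self.1 hX.nonneg
  have h : ∀ y z : Fin N → ℂ, star y ⬝ᵥ ((Bᴴ * B) *ᵥ z) = star (B *ᵥ y) ⬝ᵥ (B *ᵥ z) := by
    intro y z
    rw [← mulVec_mulVec, dotProduct_mulVec, star_mulVec]
  simp only [quad, h, star_dotProduct_self, Complex.ofReal_re]
  exact norm_star_dotProduct_sq_le _ _

/-- A small multiple of `x xᴴ`, where `x` is in the range of `X`, can be subtracted from `X`. -/
lemma exists_posSemidef_sub {X : Matrix (Fin N) (Fin N) ℂ} (hX : X.PosSemidef) (z : Fin N → ℂ) :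
    ∃ δ : ℝ, 0 < δ ∧ (X - δ • vecMulVec (X *ᵥ z) (star (X *ᵥ z))).PosSemidef := by
  have hz := quad_nonneg hX z
  refine ⟨(1 + quad X z)⁻¹, by positivity, posSemidef_iff_quad.2 ⟨?_, fun y => ?_⟩⟩
  · refine hX.isHermitian.sub ?_
    rw [IsHermitian, conjTranspose_smul, conjTranspose_vecMulVec]
    simp
  · have h1 := norm_form_sq_le hX y z
    rw [quad_sub_smul, quad_vecMulVec, norm_star_dotProduct_comm, sub_nonneg,
      inv_mul_le_iff₀ (by positivity)]
    nlinarith [quad_nonneg hX y]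

/-- If the rank is at least two, the range contains a nonzero vector orthogonal to `b`. -/
lemma exists_range_orthogonal {X : Matrix (Fin N) (Fin N) ℂ} (hX : 2 ≤ X.rank) (b : Fin N → ℂ) :
    ∃ z, X *ᵥ z ≠ 0 ∧ star b ⬝ᵥ (X *ᵥ z) = 0 := by
  let φ : LinearMap.range X.mulVecLin →ₗ[ℂ] ℂ :=
    (dotProductBilin ℂ ℂ (star b)).comp (LinearMap.range X.mulVecLin).subtype
  have hker : LinearMap.ker φ ≠ ⊥ := by
    apply LinearMap.ker_ne_bot_of_finrank_lt
    rw [Module.finrank_self]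
    exact hX
  obtain ⟨⟨x, z, rfl⟩, hx, hx0⟩ := Submodule.exists_mem_ne_zero_of_ne_bot hker
  refine ⟨z, fun h => hx0 (Subtype.ext h), ?_⟩
  simpa [φ] using hx

/-- By Cauchy–Schwarz for the form at `X z` and `z`, vanishing of `zᴴ X z` would force `‖X z‖ = 0`.
-/
lemma quad_pos_of_mulVec_ne_zero {X : Matrix (Fin N) (Fin N) ℂ} (hX : X.PosSemidef)
    {z : Fin N → ℂ} (hz : X *ᵥ z ≠ 0) : 0 < quad X z := by
  refine (quad_nonneg hX z).lt_of_ne fun h => (l2_pos hz).ne' ?_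
  have h1 := norm_form_sq_le hX (X *ᵥ z) z
  rw [← h, mul_zero, star_dotProduct_self, Complex.norm_real, Real.norm_of_nonneg (sq_nonneg _)]
    at h1
  have h2 : (l2 (X *ᵥ z) ^ 2) ^ 2 = 0 := le_antisymm h1 (sq_nonneg _)
  simpa using h2

/-- A positive semidefinite matrix of rank one is of the form `w wᴴ`. -/
lemma exists_eq_vecMulVec {X : Matrix (Fin N) (Fin N) ℂ} (hX : X.PosSemidef) (hr : X.rank = 1) :
    ∃ w : Fin N → ℂ, vecMulVec w (star w) = X := by
  obtain ⟨z, hz⟩ : ∃ z, X *ᵥ z ≠ 0 := by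
    by_contra! h
    have : X = 0 := Matrix.mulVec_injective (by funext z; rw [h z, zero_mulVec])
    simp [this] at hr
  have hq := quad_pos_of_mulVec_ne_zero hX hz
  have hqc : star z ⬝ᵥ (X *ᵥ z) = (quad X z : ℂ) := by
    refine Complex.ext (by simp [quad]) ?_
    rw [Complex.ofReal_im]
    exact hX.isHermitian.im_star_dotProduct_mulVec_self z
  have hs : ((√(quad X z) : ℝ) : ℂ) * ((√(quad X z) : ℝ) : ℂ) = quad X z := by
    rw [← Complex.ofReal_mul, Real.mul_self_sqrt hq.le]
  have hs0 : ((√(quad X z) : ℝ) : ℂ) ≠ 0 := by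
    rw [Complex.ofReal_ne_zero]; exact (Real.sqrt_pos.2 hq).ne'
  -- The range is spanned by `X z`. If `X y = c X z`, then hermiticity gives `(X z)ᴴ y = c zᴴ X z`,
  -- so `w = X z / √(zᴴ X z)` reproduces `X`.
  refine ⟨((√(quad X z) : ℝ) : ℂ)⁻¹ • (X *ᵥ z), Matrix.mulVec_injective ?_⟩
  funext y
  obtain ⟨c, hc⟩ := (finrank_eq_one_iff_of_nonzero'
    (⟨X *ᵥ z, z, rfl⟩ : LinearMap.range X.mulVecLin) (by simpa [Subtype.ext_iff] using hz)).1 hr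
    ⟨X *ᵥ y, y, rfl⟩
  have hc' : X *ᵥ y = c • (X *ᵥ z) := (congrArg Subtype.val hc).symm
  have h1 : star (X *ᵥ z) ⬝ᵥ y = c * quad X z := by
    rw [star_mulVec, hX.isHermitian.eq, ← dotProduct_mulVec, hc', dotProduct_smul, hqc,
      smul_eq_mul]
  rw [vecMulVec_mulVec, star_smul, smul_dotProduct, h1, hc', ← hs]
  simp only [op_smul_eq_smul, smul_smul]
  congr 1
  simp only [Complex.star_def, map_inv₀, Complex.conj_ofReal, smul_eq_mul]
  field_simp

/-! ### The semidefinite relaxation -/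

/-- Tuples of positive semidefinite matrices with vanishing rows in `B`. -/
def covCone (M : ℕ) (B : Finset (Fin N)) : Set (Fin M → Matrix (Fin N) (Fin N) ℂ) :=
  {X | (∀ m, (X m).PosSemidef) ∧ ∀ m, ∀ n ∈ B, X m n = 0}

lemma col_mem_uncertainty (D : Scenario N M) {m : Fin M} (hε : 0 < D.ε m) :
    D.H.col m ∈ uncertainty D m :=
  ⟨0, by simpa [l2] using hε.le, by simp⟩

lemma le_qos_rbf_iff (D : Scenario N M) {m : Fin M} (hε : 0 < D.ε m) (hσ : 0 < D.σ m)
    (W : Matrix (Fin N) (Fin M) ℂ) (c : ℝ) :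
    c ≤ qos D .RBF W m ↔ ∀ h ∈ uncertainty D m,
      c * (∑ l ∈ Finset.univ.erase m, ‖gain W l h‖ ^ 2 + D.σ m ^ 2) ≤ ‖gain W m h‖ ^ 2 := by
  -- A real infimum has its intended meaning only on a nonempty family bounded below; `ε_m > 0` and
  -- nonnegativity of the SINR provide both.
  have : Nonempty (uncertainty D m) := ⟨⟨_, col_mem_uncertainty D hε⟩⟩
  have hb : BddBelow (Set.range fun h : uncertainty D m => sinr D W m h) := by
    refine ⟨0, ?_⟩
    rintro _ ⟨h, rfl⟩
    exact div_nonneg (sq_nonneg _)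
      (add_nonneg (Finset.sum_nonneg fun _ _ => sq_nonneg _) (sq_nonneg _))
  rw [qos, le_ciInf_iff hb, Subtype.forall]
  simp only [le_sinr_iff D hσ]

lemma le_sdrQos_iff (D : Scenario N M) {m : Fin M} (hε : 0 < D.ε m) (hσ : 0 < D.σ m)
    {X : Fin M → Matrix (Fin N) (Fin N) ℂ} (hX : ∀ m, (X m).PosSemidef) (c : ℝ) :
    c ≤ sdrQos D X m ↔ ∀ h ∈ uncertainty D m,
      c * (∑ j ∈ Finset.univ.erase m, quad (X j) h + D.σ m ^ 2) ≤ quad (X m) h := by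
  have : Nonempty (uncertainty D m) := ⟨⟨_, col_mem_uncertainty D hε⟩⟩
  have hpos : ∀ h, 0 < ∑ j ∈ Finset.univ.erase m, quad (X j) h + D.σ m ^ 2 := fun h =>
    add_pos_of_nonneg_of_pos (Finset.sum_nonneg fun j _ => quad_nonneg (hX j) h) (by positivity)
  have hb : BddBelow (Set.range fun h : uncertainty D m =>
      quad (X m) h / (∑ j ∈ Finset.univ.erase m, quad (X j) h + D.σ m ^ 2)) := by
    refine ⟨0, ?_⟩
    rintro _ ⟨h, rfl⟩
    exact div_nonneg (quad_nonneg (hX m) _) (hpos _).le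
  rw [sdrQos, le_ciInf_iff hb, Subtype.forall]
  simp only [le_div_iff₀ (hpos _)]

lemma mem_sdrFeasible_iff (D : Scenario N M) (hε : ∀ m, 0 < D.ε m) (hσ : ∀ m, 0 < D.σ m)
    (B : Finset (Fin N)) (X : Fin M → Matrix (Fin N) (Fin N) ℂ) :
    X ∈ sdrFeasible D B ↔ X ∈ covCone M B ∧ ∀ m, ∀ h ∈ uncertainty D m,
      D.γ m * (∑ j ∈ Finset.univ.erase m, quad (X j) h + D.σ m ^ 2) ≤ quad (X m) h := by
  constructor
  · rintro ⟨h1, h2, h3⟩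
    exact ⟨⟨h1, h3⟩, fun m => (le_sdrQos_iff D (hε m) (hσ m) h1 _).1 (h2 m)⟩
  · rintro ⟨⟨h1, h3⟩, h2⟩
    exact ⟨h1, fun m => (le_sdrQos_iff D (hε m) (hσ m) h1 _).2 (h2 m), h3⟩

lemma quad_outer (W : Matrix (Fin N) (Fin M) ℂ) (m : Fin M) (h : Fin N → ℂ) :
    quad (outer W m) h = ‖gain W m h‖ ^ 2 := quad_vecMulVec _ _

lemma sdrPower_outer (W : Matrix (Fin N) (Fin M) ℂ) : sdrPower (outer W) = power W := by
  simp only [sdrPower, outer, trace_vecMulVec_star, l2_sq, power]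
  rw [Finset.sum_comm]
  rfl

lemma outer_mem_sdrFeasible_iff (D : Scenario N M) (hε : ∀ m, 0 < D.ε m) (hσ : ∀ m, 0 < D.σ m)
    (B : Finset (Fin N)) (W : Matrix (Fin N) (Fin M) ℂ) :
    outer W ∈ sdrFeasible D B ↔ W ∈ relaxFeasible D .RBF B := by
  have hrow : ∀ n, (∀ m, outer W m n = 0) ↔ W n = 0 := by
    intro n
    constructor
    · intro h
      funext m
      have := congrFun (h m) n
      simpa [outer, vecMulVec_apply] using this
    · intro h m
      funext k
      simp [outer, vecMulVec_apply, h]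
  have hpsd : ∀ m, (outer W m).PosSemidef := fun m => posSemidef_vecMulVec_self_star _
  rw [mem_sdrFeasible_iff D hε hσ]
  simp only [quad_outer, ← fun m => le_qos_rbf_iff D (hε m) (hσ m) W (D.γ m)]
  constructor
  · rintro ⟨⟨-, h3⟩, h2⟩
    exact ⟨h2, fun n hn => (hrow n).1 fun m => h3 m n hn⟩
  · rintro ⟨h2, h3⟩
    exact ⟨⟨hpsd, fun m n hn => (hrow n).2 (h3 n hn) m⟩, h2⟩

/-! ### Attainment for the semidefinite relaxation -/

lemma trace_re_nonneg {X : Matrix (Fin N) (Fin N) ℂ} (hX : X.PosSemidef) : 0 ≤ X.trace.re :=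
  (Complex.le_def.1 hX.trace_nonneg).1

lemma sdrPower_nonneg {B : Finset (Fin N)} {X : Fin M → Matrix (Fin N) (Fin N) ℂ}
    (hX : X ∈ covCone M B) : 0 ≤ sdrPower X :=
  Finset.sum_nonneg fun m _ => trace_re_nonneg (hX.1 m)

/-- Cauchy–Schwarz on basis vectors bounds an entry by diagonal entries. This makes the trace
control the whole matrix, hence sublevel sets compact. -/
lemma norm_entry_le_trace {X : Matrix (Fin N) (Fin N) ℂ} (hX : X.PosSemidef) (i j : Fin N) :
    ‖X i j‖ ≤ X.trace.re := by
  have hq : ∀ i, quad X (Pi.single i 1) = (X i i).re := by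
    intro i; simp [quad]
  have hle : ∀ i, quad X (Pi.single i 1) ≤ X.trace.re := by
    intro i
    rw [hq, trace, Complex.re_sum]
    refine Finset.single_le_sum (f := fun i => (X i i).re) (fun k _ => ?_) (Finset.mem_univ i)
    rw [← hq]
    exact quad_nonneg hX _
  have h1 := norm_form_sq_le hX (Pi.single i 1) (Pi.single j 1)
  have h2 : star (Pi.single i 1) ⬝ᵥ (X *ᵥ Pi.single j 1) = X i j := by
    simp
  rw [h2] at h1
  refine abs_le_of_sq_le_sq' ?_ (trace_re_nonneg hX) |>.2
  refine h1.trans ?_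
  rw [sq]
  exact mul_le_mul (hle i) (hle j) (quad_nonneg hX _) (trace_re_nonneg hX)

lemma continuous_quad (x : Fin N → ℂ) :
    Continuous fun X : Matrix (Fin N) (Fin N) ℂ => quad X x := by
  unfold quad
  fun_prop

lemma isClosed_posSemidef : IsClosed {X : Matrix (Fin N) (Fin N) ℂ | X.PosSemidef} := by
  have : {X : Matrix (Fin N) (Fin N) ℂ | X.PosSemidef} =
      {X | Xᴴ = X} ∩ ⋂ x, {X | 0 ≤ quad X x} := by
    ext X; simp [posSemidef_iff_quad, IsHermitian]
  rw [this]
  exact (isClosed_eq (by fun_prop) continuous_id).inter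
    (isClosed_iInter fun x => isClosed_le continuous_const (continuous_quad x))

lemma isClosed_covCone (B : Finset (Fin N)) : IsClosed (covCone M B) := by
  have : covCone M B = (⋂ m, {X : Fin M → Matrix (Fin N) (Fin N) ℂ | (X m).PosSemidef}) ∩
      ⋂ m, ⋂ n ∈ B, {X : Fin M → Matrix (Fin N) (Fin N) ℂ | X m n = 0} := by
    ext X; simp [covCone]
  rw [this]
  refine (isClosed_iInter fun m => isClosed_posSemidef.preimage (continuous_apply m)).inter
    (isClosed_iInter fun m => isClosed_biInter fun n _ => ?_)
  have hc : Continuous fun X : Fin M → Matrix (Fin N) (Fin N) ℂ => (X m n : Fin N → ℂ) :=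
    continuous_pi fun k => (continuous_apply m).matrix_elem n k
  exact isClosed_eq hc continuous_const

lemma continuous_sdrPower :
    Continuous (sdrPower : (Fin M → Matrix (Fin N) (Fin N) ℂ) → ℝ) := by
  unfold sdrPower
  fun_prop

lemma isCompact_covCone_le (B : Finset (Fin N)) (r : ℝ) :
    IsCompact {X ∈ covCone M B | sdrPower X ≤ r} := by
  have hK : IsCompact (Set.univ.pi fun _ : Fin M => Set.univ.pi fun _ : Fin N =>
      Set.univ.pi fun _ : Fin N => Metric.closedBall (0 : ℂ) r) :=
    isCompact_univ_pi fun _ => isCompact_univ_pi fun _ => isCompact_univ_pi fun _ =>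
      isCompact_closedBall _ _
  refine hK.of_isClosed_subset
    ((isClosed_covCone B).inter (isClosed_le continuous_sdrPower continuous_const)) ?_
  rintro X ⟨hX, hr⟩ m - i - j -
  rw [mem_closedBall_zero_iff]
  refine (norm_entry_le_trace (hX.1 m) i j).trans (le_trans ?_ hr)
  exact Finset.single_le_sum (f := fun m => Complex.re (Matrix.trace (X m)))
    (fun m _ => trace_re_nonneg (hX.1 m)) (Finset.mem_univ m)

lemma exists_sdr_optimal (D : Scenario N M) (hε : ∀ m, 0 < D.ε m) (hσ : ∀ m, 0 < D.σ m)
    (B : Finset (Fin N)) (hne : (sdrFeasible D B).Nonempty) :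
    ∃ X, IsOptimal sdrPower (sdrFeasible D B) X := by
  obtain ⟨X₀, hX₀⟩ := hne
  have hcl : IsClosed {X : Fin M → Matrix (Fin N) (Fin N) ℂ | ∀ m, ∀ h ∈ uncertainty D m,
      D.γ m * (∑ j ∈ Finset.univ.erase m, quad (X j) h + D.σ m ^ 2) ≤ quad (X m) h} := by
    simp only [Set.ofPred_forall]
    refine isClosed_iInter fun m => isClosed_biInter fun h _ => isClosed_le ?_ ?_
    · exact continuous_const.mul ((continuous_finsetSum _ fun j _ =>
        (continuous_quad h).comp (continuous_apply j)).add continuous_const)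
    · exact (continuous_quad h).comp (continuous_apply m)
  obtain ⟨X, ⟨⟨hX1, hX2⟩, hX3⟩, hmin⟩ :=
    ((isCompact_covCone_le B (sdrPower X₀)).inter_right hcl).exists_isMinOn (f := sdrPower)
      ⟨X₀, ⟨((mem_sdrFeasible_iff D hε hσ B X₀).1 hX₀).1, le_rfl⟩,
        ((mem_sdrFeasible_iff D hε hσ B X₀).1 hX₀).2⟩ continuous_sdrPower.continuousOn
  refine ⟨X, (mem_sdrFeasible_iff D hε hσ B X).2 ⟨hX1, hX3⟩, fun Y hY => ?_⟩
  have hY' := (mem_sdrFeasible_iff D hε hσ B Y).1 hY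
  by_cases hle : sdrPower Y ≤ sdrPower X₀
  · exact hmin ⟨⟨hY'.1, hle⟩, hY'.2⟩
  · exact hX2.trans (not_le.1 hle).le

/-- If all optimal covariances have rank one, the relaxation is tight. -/
lemma solvedBySDR_of_rank (D : Scenario N M) (hε : ∀ m, 0 < D.ε m) (hσ : ∀ m, 0 < D.σ m)
    (B : Finset (Fin N))
    (hrank : ∀ X, IsOptimal sdrPower (sdrFeasible D B) X → ∀ m, (X m).rank = 1) :
    SolvedBySDR D B := by
  have hfac : ∀ X, IsOptimal sdrPower (sdrFeasible D B) X → ∃ W, outer W = X := by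
    intro X hX
    choose w hw using fun m => exists_eq_vecMulVec (hX.1.1 m) (hrank X hX m)
    exact ⟨Matrix.of fun n m => w m n, funext hw⟩
  refine ⟨le_antisymm ?_ ?_, ?_, fun X hX => ⟨hrank X hX, hfac X hX, ?_⟩⟩
  · refine optValue_le_optValue fun Y hY => ?_
    obtain ⟨X, hX⟩ := exists_sdr_optimal D hε hσ B ⟨Y, hY⟩
    obtain ⟨W, rfl⟩ := hfac X hX
    exact ⟨W, (outer_mem_sdrFeasible_iff D hε hσ B W).1 hX.1,
      (sdrPower_outer W).symm.le.trans (hX.2 hY)⟩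
  · exact optValue_le_optValue fun W hW =>
      ⟨outer W, (outer_mem_sdrFeasible_iff D hε hσ B W).2 hW, (sdrPower_outer W).le⟩
  · rintro ⟨W, hW⟩
    exact exists_sdr_optimal D hε hσ B ⟨_, (outer_mem_sdrFeasible_iff D hε hσ B W).2 hW⟩
  · rintro W rfl
    refine ⟨(outer_mem_sdrFeasible_iff D hε hσ B W).1 hX.1, fun V hV => ?_⟩
    have := hX.2 ((outer_mem_sdrFeasible_iff D hε hσ B V).2 hV)
    rwa [Set.mem_ofPred_eq, sdrPower_outer, sdrPower_outer] at this

/-! ### Multipliers of the semidefinite relaxation -/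

section

-- The duality theorem asks for normed spaces; in finite dimension any norm serves.
attribute [local instance] Matrix.normedAddCommGroup Matrix.normedSpace

/-- Second moment, first moment and mass of a positive measure on the space of channels. -/
abbrev Moments (N : ℕ) : Type := Matrix (Fin N) (Fin N) ℂ × (Fin N → ℂ) × ℝ

/-- The moments of the point mass at `h`. -/
def pointMass (h : Fin N → ℂ) : Moments N := (vecMulVec h (star h), h, 1)

/-- The integral of `h ↦ α |xᴴ h|² + Re (kᴴ h) + β` in terms of moments. -/
def integral (α : ℝ) (x k : Fin N → ℂ) (β : ℝ) : Moments N →ₗ[ℝ] ℝ where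
  toFun p := α * quad p.1 x + (star k ⬝ᵥ p.2.1).re + β * p.2.2
  map_add' p q := by
    simp only [← trForm_vecMulVec, trForm_comm _ (vecMulVec x (star x)), Prod.fst_add,
      Prod.snd_add, map_add, dotProduct_add, Complex.add_re]
    ring
  map_smul' r p := by
    simp only [← trForm_vecMulVec, trForm_comm _ (vecMulVec x (star x)), Prod.smul_fst,
      Prod.smul_snd, map_smul, dotProduct_smul, Complex.smul_re, smul_eq_mul, RingHom.id_apply]
    ring

lemma integral_apply (α : ℝ) (x k : Fin N → ℂ) (β : ℝ) (p : Moments N) :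
    integral α x k β p = α * quad p.1 x + (star k ⬝ᵥ p.2.1).re + β * p.2.2 := rfl

lemma integral_pointMass (α : ℝ) (x k : Fin N → ℂ) (β : ℝ) (h : Fin N → ℂ) :
    integral α x k β (pointMass h) = α * ‖star x ⬝ᵥ h‖ ^ 2 + (star k ⬝ᵥ h).re + β := by
  rw [integral_apply, pointMass, quad_vecMulVec, norm_star_dotProduct_comm h x, mul_one]

lemma trForm_add_left (S T X : Matrix (Fin N) (Fin N) ℂ) :
    trForm (S + T) X = trForm S X + trForm T X := by
  rw [trForm_comm, map_add, trForm_comm X, trForm_comm X]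

lemma trForm_smul_left (r : ℝ) (S X : Matrix (Fin N) (Fin N) ℂ) :
    trForm (r • S) X = r * trForm S X := by
  rw [trForm_comm, map_smul, trForm_comm X, smul_eq_mul]

/-- The pairing of covariances with multipliers of the SINR constraints. -/
def sinrForm (γ : Fin M → ℝ) :
    (Fin M → Matrix (Fin N) (Fin N) ℂ) →ₗ[ℝ] (Fin M → Moments N) →ₗ[ℝ] ℝ :=
  LinearMap.mk₂ ℝ (fun X y => ∑ m, (trForm (y m).1 (X m) / γ m -
      ∑ j ∈ Finset.univ.erase m, trForm (y j).1 (X m)))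
    (fun X X' y => by
      rw [← Finset.sum_add_distrib]
      refine Finset.sum_congr rfl fun m _ => ?_
      simp only [Pi.add_apply, map_add, Finset.sum_add_distrib]
      ring)
    (fun r X y => by
      rw [smul_eq_mul, Finset.mul_sum]
      refine Finset.sum_congr rfl fun m _ => ?_
      simp only [Pi.smul_apply, map_smul, smul_eq_mul, ← Finset.mul_sum]
      ring)
    (fun X y y' => by
      rw [← Finset.sum_add_distrib]
      refine Finset.sum_congr rfl fun m _ => ?_
      simp only [Pi.add_apply, Prod.fst_add, trForm_add_left, Finset.sum_add_distrib]
      ring)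
    (fun r X y => by
      rw [smul_eq_mul, Finset.mul_sum]
      refine Finset.sum_congr rfl fun m _ => ?_
      simp only [Pi.smul_apply, Prod.smul_fst, trForm_smul_left, ← Finset.mul_sum]
      ring)

lemma sinrForm_apply (γ : Fin M → ℝ) (X : Fin M → Matrix (Fin N) (Fin N) ℂ)
    (y : Fin M → Moments N) :
    sinrForm γ X y = ∑ m, (trForm (y m).1 (X m) / γ m -
      ∑ j ∈ Finset.univ.erase m, trForm (y j).1 (X m)) := rfl

lemma sinrForm_single_left (γ : Fin M → ℝ) (m : Fin M) (Z : Matrix (Fin N) (Fin N) ℂ)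
    (y : Fin M → Moments N) :
    sinrForm γ (Pi.single m Z) y =
      trForm (y m).1 Z / γ m - ∑ j ∈ Finset.univ.erase m, trForm (y j).1 Z := by
  rw [sinrForm_apply, Finset.sum_eq_single m]
  · simp
  · intro j _ hj
    simp [Pi.single_eq_of_ne hj]
  · simp

/-- `sinrForm` collects terms by covariance; pairing with a single point mass recovers the SINR
constraint at that channel, divided by `γ m`. -/
lemma sinrForm_pointMass (γ : Fin M → ℝ) (X : Fin M → Matrix (Fin N) (Fin N) ℂ) (m : Fin M)
    (h : Fin N → ℂ) :
    sinrForm γ X (Pi.single m (pointMass h)) =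
      quad (X m) h / γ m - ∑ j ∈ Finset.univ.erase m, quad (X j) h := by
  have h0 : ∀ j i, trForm (Prod.fst ((Pi.single m (pointMass h) : Fin M → Moments N) j)) (X i) =
      if j = m then quad (X i) h else 0 := by
    intro j i
    rw [trForm_comm]
    split_ifs with hj
    · subst hj; rw [Pi.single_eq_same, pointMass, trForm_vecMulVec]
    · rw [Pi.single_eq_of_ne hj]; simp
  rw [sinrForm_apply]
  simp only [h0, Finset.sum_ite_eq', Finset.mem_erase, Finset.mem_univ, and_true]
  rw [Finset.sum_sub_distrib]
  congr 1
  · rw [Finset.sum_eq_single m (fun j _ hj => by simp [hj]) (by simp), if_pos rfl]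
  · rw [← Finset.sum_filter]
    refine Finset.sum_congr (Finset.ext fun j => ?_) fun _ _ => rfl
    simp [eq_comm]

lemma isCompact_l2_le (r : ℝ) : IsCompact {e : Fin N → ℂ | l2 e ≤ r} := by
  refine (isCompact_univ_pi fun _ : Fin N => isCompact_closedBall (0 : ℂ) r).of_isClosed_subset
    (isClosed_le ?_ continuous_const) fun e he i _ => ?_
  · exact (PiLp.continuous_toLp 2 _).norm
  · rw [mem_closedBall_zero_iff]
    exact (PiLp.norm_apply_le (WithLp.toLp 2 e : EuclideanSpace ℂ (Fin N)) i).trans he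

/-- The multipliers that correspond to single SINR constraints. -/
def constraintMultipliers (D : Scenario N M) : Set (Fin M → Moments N) :=
  {g | ∃ m, ∃ h ∈ uncertainty D m, g = Pi.single m (pointMass h)}

lemma isBounded_constraintMultipliers (D : Scenario N M) :
    Bornology.IsBounded (constraintMultipliers D) := by
  have hc : ∀ m, Continuous fun e : Fin N → ℂ =>
      (Pi.single m (pointMass (D.H.col m + e)) : Fin M → Moments N) := by
    intro m
    refine (continuous_single m).comp ?_
    unfold pointMass
    fun_prop
  have : constraintMultipliers D = ⋃ m, (fun e : Fin N → ℂ =>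
      (Pi.single m (pointMass (D.H.col m + e)) : Fin M → Moments N)) '' {e | l2 e ≤ D.ε m} := by
    ext g
    simp only [constraintMultipliers, uncertainty, Set.mem_iUnion, Set.mem_image,
      Set.mem_ofPred_eq]
    constructor
    · rintro ⟨m, _, ⟨e, he, rfl⟩, rfl⟩
      exact ⟨m, e, he, rfl⟩
    · rintro ⟨m, e, he, rfl⟩
      exact ⟨m, _, ⟨e, he, rfl⟩, rfl⟩
  rw [this]
  exact Bornology.isBounded_iUnion.2 fun m =>
    ((isCompact_l2_le _).image (hc m)).isBounded

/-- Multipliers of the semidefinite relaxation: moments `y m` of a positive measure on the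
uncertainty set of each user `m` for which the dual slack matrices are nonnegative on positive
semidefinite matrices, with complementary slackness. -/
lemma exists_sdr_multiplier (D : Scenario N M) (hε : ∀ m, 0 < D.ε m) (hσ : ∀ m, 0 < D.σ m)
    (hγ : ∀ m, 0 < D.γ m) (B : Finset (Fin N)) {X : Fin M → Matrix (Fin N) (Fin N) ℂ}
    (hX : IsOptimal sdrPower (sdrFeasible D B) X)
    {X₀ : Fin M → Matrix (Fin N) (Fin N) ℂ} (hX₀ : X₀ ∈ covCone M B)
    (hslater : ∀ m, ∀ h ∈ uncertainty D m, D.σ m ^ 2 + 1 ≤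
      quad (X₀ m) h / D.γ m - ∑ j ∈ Finset.univ.erase m, quad (X₀ j) h) :
    ∃ y : Fin M → Moments N,
      (∀ m, ∀ φ : Moments N →ₗ[ℝ] ℝ, (∀ h ∈ uncertainty D m, 0 ≤ φ (pointMass h)) → 0 ≤ φ (y m)) ∧
      (∀ m, ∀ Z : Matrix (Fin N) (Fin N) ℂ, Z.PosSemidef → (∀ n ∈ B, Z n = 0) →
        trForm (y m).1 Z / D.γ m - ∑ j ∈ Finset.univ.erase m, trForm (y j).1 Z ≤ Z.trace.re) ∧
      ∀ m, trForm (y m).1 (X m) / D.γ m - ∑ j ∈ Finset.univ.erase m, trForm (y j).1 (X m) =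
        (X m).trace.re := by
  let p : (Fin M → Matrix (Fin N) (Fin N) ℂ) →ₗ[ℝ] ℝ := ∑ m, (trForm 1).comp (LinearMap.proj m)
  have hp : ∀ Z, p Z = sdrPower Z := fun Z => by
    simp [p, trForm_one, sdrPower]
  let s : (Fin M → Moments N) →ₗ[ℝ] ℝ :=
    ∑ m, (integral 0 0 0 (D.σ m ^ 2)).comp (LinearMap.proj m)
  have hs : ∀ m h, s (Pi.single m (pointMass h)) = D.σ m ^ 2 := fun m h => by
    simp only [s, LinearMap.sum_apply, LinearMap.comp_apply, LinearMap.proj_apply]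
    rw [Finset.sum_eq_single m]
    · rw [Pi.single_eq_same, integral_pointMass]; simp
    · intro j _ hj; rw [Pi.single_eq_of_ne hj, map_zero]
    · simp
  have hcons : ∀ Z : Fin M → Matrix (Fin N) (Fin N) ℂ,
      (∀ g ∈ constraintMultipliers D, s g ≤ sinrForm D.γ Z g) ↔
      ∀ m, ∀ h ∈ uncertainty D m,
        D.γ m * (∑ j ∈ Finset.univ.erase m, quad (Z j) h + D.σ m ^ 2) ≤ quad (Z m) h := by
    intro Z
    have key : ∀ m h, s (Pi.single m (pointMass h)) ≤ sinrForm D.γ Z (Pi.single m (pointMass h)) ↔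
        D.γ m * (∑ j ∈ Finset.univ.erase m, quad (Z j) h + D.σ m ^ 2) ≤ quad (Z m) h := by
      intro m h
      rw [hs, sinrForm_pointMass, le_sub_iff_add_le, le_div_iff₀ (hγ m), mul_comm, add_comm]
    constructor
    · exact fun H m h hh => (key m h).1 (H _ ⟨m, h, hh, rfl⟩)
    · rintro H _ ⟨m, h, hh, rfl⟩
      exact (key m h).2 (H m h hh)
  have hXf := (mem_sdrFeasible_iff D hε hσ B X).1 hX.1
  have hcone : ∀ Z ∈ covCone M B, ∀ t : ℝ, 0 ≤ t → t • Z ∈ covCone M B := fun Z hZ t ht =>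
    ⟨fun m => (hZ.1 m).smul ht, fun m n hn => by
      change t • Z m n = 0
      rw [hZ.2 m n hn, smul_zero]⟩
  have hadd : ∀ Z ∈ covCone M B, ∀ Z' ∈ covCone M B, Z + Z' ∈ covCone M B := fun Z hZ Z' hZ' =>
    ⟨fun m => (hZ.1 m).add (hZ'.1 m), fun m n hn => by
      change Z m n + Z' m n = 0
      rw [hZ.2 m n hn, hZ'.2 m n hn, add_zero]⟩
  obtain ⟨y, hy1, hy2, hy3⟩ := exists_lagrange_multiplier (K := covCone M B)
    (fun Z hZ Z' hZ' t u ht hu _ => hadd _ (hcone _ hZ _ ht) _ (hcone _ hZ' _ hu)) hcone hadd p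
    (fun Z hZ => by rw [hp]; exact sdrPower_nonneg hZ)
    (fun r => by simp only [hp]; exact isCompact_covCone_le B r) (sinrForm D.γ) s
    (isBounded_constraintMultipliers D) hXf.1 ((hcons X).2 hXf.2)
    (fun Z hZ hZG => by
      rw [hp, hp]
      exact hX.2 ((mem_sdrFeasible_iff D hε hσ B Z).2 ⟨hZ, (hcons Z).1 hZG⟩))
    hX₀
    (by
      rintro _ ⟨m, h, hh, rfl⟩
      rw [hs, sinrForm_pointMass]
      exact hslater m h hh)
  have hnonneg : ∀ m, ∀ Z : Matrix (Fin N) (Fin N) ℂ, Z.PosSemidef → (∀ n ∈ B, Z n = 0) →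
      trForm (y m).1 Z / D.γ m - ∑ j ∈ Finset.univ.erase m, trForm (y j).1 Z ≤ Z.trace.re := by
    intro m Z hZ hZB
    -- The tuple with the single block `Z` isolates the dual slack of user `m`.
    have := hy2 (Pi.single m Z) ⟨fun j => ?_, fun j n hn => ?_⟩
    · have htr : sdrPower (Pi.single m Z : Fin M → Matrix (Fin N) (Fin N) ℂ) = Z.trace.re := by
        rw [sdrPower, Finset.sum_eq_single m]
        · simp
        · intro j _ hj; simp [Pi.single_eq_of_ne hj]
        · simp
      rwa [sinrForm_single_left, hp, htr] at this
    · by_cases hj : j = m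
      · subst hj; simpa using hZ
      · rw [Pi.single_eq_of_ne hj]; exact PosSemidef.zero
    · by_cases hj : j = m
      · subst hj; simpa using hZB n hn
      · rw [Pi.single_eq_of_ne hj]; rfl
  refine ⟨y, fun m φ hφ => ?_, hnonneg, fun m => ?_⟩
  · refine hy1 (φ.comp (LinearMap.proj m)) ?_
    rintro _ ⟨j, h, hh, rfl⟩
    rw [LinearMap.comp_apply, LinearMap.proj_apply]
    by_cases hj : m = j
    · subst hj; rw [Pi.single_eq_same]; exact hφ h hh
    · rw [Pi.single_eq_of_ne hj, map_zero]
  -- Only the sum of the slackness identities is known; since each term is an inequality, equality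
  -- of sums forces equality termwise.
  · have hle : ∀ m ∈ Finset.univ, trForm (y m).1 (X m) / D.γ m -
        ∑ j ∈ Finset.univ.erase m, trForm (y j).1 (X m) ≤ (X m).trace.re := fun m _ =>
      hnonneg m (X m) (hXf.1.1 m) (hXf.1.2 m)
    rw [hp, sinrForm_apply, sdrPower] at hy3
    exact (Finset.sum_eq_sum_iff_of_le hle).1 hy3.symm m (Finset.mem_univ m)

end

/-! ### Zero-forcing directions -/

/-- `u` has no entries in `B`, is orthogonal to the channels of all users other than `m`, its inner
product with the channel of user `m` is `‖u‖²`, and `‖u‖² / ε_m²` is large. -/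
structure IsZeroForcing (D : Scenario N M) (B : Finset (Fin N)) (m : Fin M) (u : Fin N → ℂ) :
    Prop where
  apply_eq_zero : ∀ n ∈ B, u n = 0
  dot_self : star u ⬝ᵥ D.H.col m = ((l2 u ^ 2 : ℝ) : ℂ)
  dot_ne : ∀ j, j ≠ m → star u ⬝ᵥ D.H.col j = 0
  bound : D.ε m ^ 2 * ((1 + M) + (1 + 1 / M) * (M - 1) * D.γ m) < l2 u ^ 2

lemma conjTranspose_removeCol_mulVec_complProj {ι : Type*} [Fintype ι] [DecidableEq ι]
    (H : Matrix ι (Fin M) ℂ) (m : Fin M)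
    (hG : IsUnit ((removeCol H m)ᴴ * removeCol H m).det) (x : ι → ℂ) :
    (removeCol H m)ᴴ *ᵥ (complProj H m *ᵥ x) = 0 := by
  rw [mulVec_mulVec, complProj, Matrix.mul_sub, Matrix.mul_one, ← Matrix.mul_assoc,
    ← Matrix.mul_assoc, Matrix.mul_nonsing_inv _ hG, Matrix.one_mul, sub_self, zero_mulVec]

lemma exists_isZeroForcing (D : Scenario N M) (hε : ∀ m, 0 < D.ε m) (hD : ChannelCondition D L)
    {B : Finset (Fin N)} (hB : B.card + L ≤ N) (m : Fin M) : ∃ u, IsZeroForcing D B m u := by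
  have hcard : L ≤ (Bᶜ).card := by
    rw [Finset.card_compl, Fintype.card_fin]; omega
  obtain ⟨hG, hbound⟩ := hD Bᶜ hcard m
  have hMpos : (0 : ℝ) < M := by exact_mod_cast m.pos
  set H := subChannel D Bᶜ with hH
  set v := complProj H m *ᵥ H.col m with hv
  have hRv : (removeCol H m)ᴴ *ᵥ v = 0 := conjTranspose_removeCol_mulVec_complProj H m hG _
  have hvR : star v ᵥ* removeCol H m = 0 := by
    have := congrArg star hRv
    rwa [star_mulVec, conjTranspose_conjTranspose, star_zero] at this
  -- The witness is `Π_m h̃_m` for the rows outside `B`, extended by zero.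
  let u : Fin N → ℂ := fun n => if h : n ∈ Bᶜ then v ⟨n, h⟩ else 0
  have hsum : ∀ f : Fin N → ℂ → ℂ, (∀ n, f n 0 = 0) →
      ∑ n, f n (u n) = ∑ n : (Bᶜ : Finset (Fin N)), f n (v n) := by
    intro f hf
    have h1 : ∑ n, f n (u n) = ∑ n ∈ Bᶜ, f n (u n) := by
      symm
      refine Finset.sum_subset (Finset.subset_univ _) fun n _ hn => ?_
      simp only [u, dif_neg hn, hf]
    rw [h1, ← Finset.sum_coe_sort]
    refine Finset.sum_congr rfl fun n _ => ?_
    have : u n = v n := by simp only [u, dif_pos n.2]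
    rw [this]
  have hdot : ∀ j, star u ⬝ᵥ D.H.col j = star v ⬝ᵥ H.col j := fun j =>
    hsum (fun n z => star z * D.H n j) (by simp)
  have hl2 : l2 u ^ 2 = l2 v ^ 2 := by
    have : star u ⬝ᵥ u = star v ⬝ᵥ v := hsum (fun _ z => star z * z) (by simp)
    rw [star_dotProduct_self, star_dotProduct_self] at this
    exact_mod_cast this
  refine ⟨u, fun n hn => by simp [u, hn], ?_, fun j hj => ?_, ?_⟩
  -- The part of `h̃_m` removed by the projection lies in the span of the other channels, which is
  -- orthogonal to `v`.
  · have hcol : H.col m = v + removeCol H m *ᵥ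
        ((((removeCol H m)ᴴ * removeCol H m)⁻¹ * (removeCol H m)ᴴ) *ᵥ H.col m) := by
      rw [hv, complProj, sub_mulVec, one_mulVec, mulVec_mulVec, ← Matrix.mul_assoc]
      abel
    rw [hdot, hcol, dotProduct_add, dotProduct_mulVec _ (removeCol H m), hvR, zero_dotProduct,
      add_zero, star_dotProduct_self, hl2]
  · rw [hdot]
    exact congrFun hvR ⟨j, hj⟩
  -- The two forms of the bound agree because `M - 1/M = (1 + 1/M)(M - 1)`.
  · rw [gt_iff_lt, lt_div_iff₀ (pow_pos (hε m) 2)] at hbound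
    rw [hl2]
    refine lt_of_eq_of_lt ?_ hbound
    field_simp
    ring

lemma IsZeroForcing.l2_sq_pos {D : Scenario N M} {B : Finset (Fin N)} {m : Fin M}
    {u : Fin N → ℂ} (hu : IsZeroForcing D B m u) (hγ : 0 < D.γ m) : 0 < l2 u ^ 2 := by
  have hM : (1 : ℝ) ≤ M := by exact_mod_cast m.pos
  refine lt_of_le_of_lt ?_ hu.bound
  have : (0 : ℝ) ≤ M - 1 := by linarith
  positivity

lemma IsZeroForcing.norm_dot_sq_le {D : Scenario N M} {B : Finset (Fin N)} {m j : Fin M}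
    {u : Fin N → ℂ} (hu : IsZeroForcing D B m u) (hj : j ≠ m) {h : Fin N → ℂ}
    (hh : h ∈ uncertainty D j) : ‖star u ⬝ᵥ h‖ ^ 2 ≤ D.ε j ^ 2 * l2 u ^ 2 := by
  obtain ⟨e, he, rfl⟩ := hh
  rw [dotProduct_add, hu.dot_ne j hj, zero_add, mul_comm]
  refine (norm_star_dotProduct_sq_le u e).trans (mul_le_mul_of_nonneg_left ?_ (sq_nonneg _))
  exact pow_le_pow_left₀ (norm_nonneg _) he 2

lemma norm_sq_le_young {t : ℝ} (ht : 0 < t) (a b : ℂ) :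
    ‖a‖ ^ 2 ≤ (1 + 1 / t) * ‖b‖ ^ 2 + (1 + t) * ‖b - a‖ ^ 2 := by
  have h1 : ‖a‖ ≤ ‖b‖ + ‖b - a‖ := by
    have := norm_sub_le b (b - a)
    rwa [sub_sub_cancel] at this
  have h2 : ‖a‖ ^ 2 ≤ (‖b‖ + ‖b - a‖) ^ 2 := pow_le_pow_left₀ (norm_nonneg _) h1 2
  refine h2.trans ?_
  have h3 : 0 ≤ (1 / t) * (‖b‖ - t * ‖b - a‖) ^ 2 := by positivity
  have h4 : (1 / t) * (‖b‖ - t * ‖b - a‖) ^ 2 =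
      1 / t * ‖b‖ ^ 2 - 2 * (‖b‖ * ‖b - a‖) + t * ‖b - a‖ ^ 2 := by
    field_simp
    ring
  nlinarith

/-- Lower bound for the useful signal of a zero-forcing direction at a channel at distance `ρ`. -/
lemma IsZeroForcing.le_norm_dot_sq {D : Scenario N M} {B : Finset (Fin N)} {m : Fin M}
    {u : Fin N → ℂ} (hu : IsZeroForcing D B m u) (h : Fin N → ℂ) :
    (l2 u ^ 2) ^ 2 ≤ (1 + 1 / M) * ‖star u ⬝ᵥ h‖ ^ 2 +
      (1 + M) * (l2 u ^ 2 * l2 (h - D.H.col m) ^ 2) := by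
  have hM : (0 : ℝ) < M := by exact_mod_cast m.pos
  -- The weight `t = M` is what produces the constants `1 + M` and `1 + 1/M` of the channel
  -- condition.
  have h1 := norm_sq_le_young hM (star u ⬝ᵥ D.H.col m) (star u ⬝ᵥ h)
  rw [← dotProduct_sub] at h1
  have h2 := norm_star_dotProduct_sq_le u (h - D.H.col m)
  rw [hu.dot_self, Complex.norm_real, Real.norm_of_nonneg (sq_nonneg _)] at h1
  refine h1.trans ?_
  gcongr

lemma l2_sub_col_le {D : Scenario N M} {m : Fin M} {h : Fin N → ℂ} (hh : h ∈ uncertainty D m) :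
    l2 (h - D.H.col m) ^ 2 ≤ D.ε m ^ 2 := by
  obtain ⟨e, he, rfl⟩ := hh
  rw [add_sub_cancel_left]
  exact pow_le_pow_left₀ (norm_nonneg _) he 2

lemma vecMulVec_row_eq_zero {u : Fin N → ℂ} {n : Fin N} (hn : u n = 0) :
    vecMulVec u (star u) n = 0 := by
  funext k; simp [vecMulVec_apply, hn]

/-- Zero-forcing beamformers of large equal power are strictly feasible. -/
lemma exists_strictly_feasible (D : Scenario N M) (hγ : ∀ m, 0 < D.γ m) {B : Finset (Fin N)}
    {u : Fin M → Fin N → ℂ} (hu : ∀ m, IsZeroForcing D B m (u m)) :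
    ∃ X ∈ covCone M B, ∀ m, ∀ h ∈ uncertainty D m, D.σ m ^ 2 + 1 ≤
      quad (X m) h / D.γ m - ∑ j ∈ Finset.univ.erase m, quad (X j) h := by
  -- `κ m` is a lower bound for the worst-case margin of user `m` per unit of power: useful signal
  -- over `γ m`, minus leakage `ε_m²` from each of the `M - 1` other beams. Its positivity is
  -- exactly the zero-forcing bound.
  let κ : Fin M → ℝ := fun m =>
    (l2 (u m) ^ 2 - (1 + M) * D.ε m ^ 2) / ((1 + 1 / M) * D.γ m) - (M - 1) * D.ε m ^ 2
  have hM : ∀ _ : Fin M, (0 : ℝ) < M := fun m => by exact_mod_cast m.pos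
  have hκ : ∀ m, 0 < κ m := by
    intro m
    have := hM m
    have := hγ m
    rw [sub_pos, lt_div_iff₀ (by positivity)]
    linarith [(hu m).bound]
  have hd : ∀ m, 0 < l2 (u m) ^ 2 := fun m => (hu m).l2_sq_pos (hγ m)
  -- A sum rather than a maximum: it dominates every requirement `(σ_m² + 1) / κ m`.
  set p : ℝ := ∑ m, (D.σ m ^ 2 + 1) / κ m with hp
  have hterm : ∀ m, 0 ≤ (D.σ m ^ 2 + 1) / κ m := fun m =>
    div_nonneg (by positivity) (hκ m).le
  have hp0 : 0 ≤ p := Finset.sum_nonneg fun m _ => hterm m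
  have hquad : ∀ m h, quad ((p / l2 (u m) ^ 2) • vecMulVec (u m) (star (u m))) h =
      p / l2 (u m) ^ 2 * ‖star (u m) ⬝ᵥ h‖ ^ 2 := by
    intro m h
    rw [← quad_vecMulVec, ← trForm_vecMulVec, trForm_smul_left, trForm_vecMulVec]
  refine ⟨fun m => (p / l2 (u m) ^ 2) • vecMulVec (u m) (star (u m)),
    ⟨fun m => ?_, fun m n hn => ?_⟩, fun m h hh => ?_⟩
  · exact (posSemidef_vecMulVec_self_star _).smul (div_nonneg hp0 (hd m).le)
  · change (p / l2 (u m) ^ 2) • vecMulVec (u m) (star (u m)) n = 0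
    rw [vecMulVec_row_eq_zero ((hu m).apply_eq_zero n hn), smul_zero]
  · simp only [hquad]
    have hMm := hM m
    have hγm := hγ m
    have hint : ∑ j ∈ Finset.univ.erase m, p / l2 (u j) ^ 2 * ‖star (u j) ⬝ᵥ h‖ ^ 2 ≤
        p * ((M - 1) * D.ε m ^ 2) := by
      have : ∀ j ∈ Finset.univ.erase m, p / l2 (u j) ^ 2 * ‖star (u j) ⬝ᵥ h‖ ^ 2 ≤
          p * D.ε m ^ 2 := by
        intro j hj
        have h1 := (hu j).norm_dot_sq_le (Finset.ne_of_mem_erase hj).symm hh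
        calc p / l2 (u j) ^ 2 * ‖star (u j) ⬝ᵥ h‖ ^ 2
            ≤ p / l2 (u j) ^ 2 * (D.ε m ^ 2 * l2 (u j) ^ 2) :=
              mul_le_mul_of_nonneg_left h1 (div_nonneg hp0 (hd j).le)
          _ = p * D.ε m ^ 2 := by
              rw [mul_comm (D.ε m ^ 2), ← mul_assoc, div_mul_cancel₀ _ (hd j).ne']
      refine (Finset.sum_le_sum this).trans_eq ?_
      rw [Finset.sum_const, Finset.card_erase_of_mem (Finset.mem_univ m), Finset.card_univ,
        Fintype.card_fin, nsmul_eq_mul, Nat.cast_sub m.pos]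
      push_cast
      ring
    have hsig : p * ((l2 (u m) ^ 2 - (1 + M) * D.ε m ^ 2) / ((1 + 1 / M) * D.γ m)) ≤
        p / l2 (u m) ^ 2 * ‖star (u m) ⬝ᵥ h‖ ^ 2 / D.γ m := by
      have h1 := (hu m).le_norm_dot_sq h
      have h2 := l2_sub_col_le hh
      have h3 : (l2 (u m) ^ 2) * (l2 (u m) ^ 2 - (1 + M) * D.ε m ^ 2) ≤
          (1 + 1 / M) * ‖star (u m) ⬝ᵥ h‖ ^ 2 := by
        have : (1 + (M : ℝ)) * (l2 (u m) ^ 2 * l2 (h - D.H.col m) ^ 2) ≤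
            (1 + M) * (l2 (u m) ^ 2 * D.ε m ^ 2) := by
          have := (hd m).le
          gcongr
        linarith
      have h4 : (l2 (u m) ^ 2 - (1 + M) * D.ε m ^ 2) / ((1 + 1 / M) * D.γ m) ≤
          ‖star (u m) ⬝ᵥ h‖ ^ 2 / (l2 (u m) ^ 2 * D.γ m) := by
        have := hd m
        rw [div_le_div_iff₀ (by positivity) (by positivity)]
        nlinarith
      refine (mul_le_mul_of_nonneg_left h4 hp0).trans_eq ?_
      have := (hd m).ne'
      field_simp
    have hpκ : D.σ m ^ 2 + 1 ≤ p * κ m := by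
      rw [← div_le_iff₀ (hκ m)]
      exact Finset.single_le_sum (f := fun m => (D.σ m ^ 2 + 1) / κ m) (fun j _ => hterm j)
        (Finset.mem_univ m)
    have : p * κ m = p * ((l2 (u m) ^ 2 - (1 + M) * D.ε m ^ 2) / ((1 + 1 / M) * D.γ m)) -
        p * ((M - 1) * D.ε m ^ 2) := by simp only [κ]; ring
    linarith

/-! ### Rank one -/

/-- The nonnegative function `C - |xᴴ h|²` is integrated against the measure. -/
lemma quad_le_of_mass (D : Scenario N M) {m : Fin M} {y : Moments N}
    (hy : ∀ φ : Moments N →ₗ[ℝ] ℝ, (∀ h ∈ uncertainty D m, 0 ≤ φ (pointMass h)) → 0 ≤ φ y)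
    {x : Fin N → ℂ} {C : ℝ} (hC : ∀ h ∈ uncertainty D m, ‖star x ⬝ᵥ h‖ ^ 2 ≤ C) :
    quad y.1 x ≤ C * y.2.2 := by
  have := hy (integral (-1) x 0 C) fun h hh => by
    rw [integral_pointMass]
    simpa using hC h hh
  rw [integral_apply] at this
  simp only [star_zero, zero_dotProduct, Complex.zero_re] at this
  linarith

lemma l2_sq_sub {ι : Type*} [Fintype ι] (x y : ι → ℂ) :
    l2 (x - y) ^ 2 = l2 x ^ 2 - 2 * (star y ⬝ᵥ x).re + l2 y ^ 2 := by
  have h := star_dotProduct_self (x - y)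
  have hx := star_dotProduct_self x
  have hy := star_dotProduct_self y
  rw [star_sub, sub_dotProduct, dotProduct_sub, dotProduct_sub, hx, hy] at h
  have h1 := congrArg Complex.re h
  have h2 : (star x ⬝ᵥ y).re = (star y ⬝ᵥ x).re := by
    rw [star_dotProduct]; simp
  simp only [Complex.sub_re, Complex.ofReal_re] at h1
  linarith

/-- Variance decomposition of a positive measure on an uncertainty set about its barycenter. -/
lemma exists_barycenter (D : Scenario N M) {m : Fin M} {y : Moments N}
    (hy : ∀ φ : Moments N →ₗ[ℝ] ℝ, (∀ h ∈ uncertainty D m, 0 ≤ φ (pointMass h)) → 0 ≤ φ y)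
    (hc : 0 < y.2.2) :
    ∃ b : Fin N → ℂ, (∀ x, y.2.2 * ‖star x ⬝ᵥ b‖ ^ 2 ≤ quad y.1 x) ∧
      ∀ x r, star b ⬝ᵥ x = 0 → l2 x ^ 2 ≤ r →
        quad y.1 x + y.2.2 * l2 (b - D.H.col m) ^ 2 * r ≤ D.ε m ^ 2 * y.2.2 * r := by
  obtain ⟨S, b₀, c⟩ := y
  simp only at hc ⊢
  obtain ⟨b, rfl⟩ : ∃ b, b₀ = (c : ℂ) • b :=
    ⟨(c : ℂ)⁻¹ • b₀, by rw [smul_smul, mul_inv_cancel₀ (by exact_mod_cast hc.ne'), one_smul]⟩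
  refine ⟨b, fun x => ?_, fun x r hx hxr => ?_⟩
  · set a := star x ⬝ᵥ b with ha
    have hk : ∀ z : Fin N → ℂ, (star ((-2 * a) • x) ⬝ᵥ z) = -2 * (star a * (star x ⬝ᵥ z)) := by
      intro z
      rw [star_smul, smul_dotProduct, smul_eq_mul]
      simp
      ring
    have hre : ∀ z : ℂ, ‖z - a‖ ^ 2 = ‖z‖ ^ 2 + (-2 * (star a * z)).re + ‖a‖ ^ 2 := by
      intro z
      simp [complex_norm_sq]
      ring
    -- The integrand is `|xᴴ h - a|²`.
    have := hy (integral 1 x ((-2 * a) • x) (‖a‖ ^ 2)) fun h hh => by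
      rw [integral_pointMass, hk, one_mul, ← hre]
      positivity
    rw [integral_apply, hk, dotProduct_smul, ← ha, smul_eq_mul] at this
    have h2 : (-2 * (star a * ((c : ℂ) * a))).re = -2 * (c * ‖a‖ ^ 2) := by
      simp [complex_norm_sq]
      ring
    rw [h2] at this
    simp only at this
    linarith
  · set e := b - D.H.col m with he
    have hr0 : 0 ≤ r := (sq_nonneg _).trans hxr
    have hk : ∀ z : Fin N → ℂ, (star (((-2 * r : ℝ) : ℂ) • e) ⬝ᵥ z).re =
        -2 * r * (star e ⬝ᵥ z).re := by
      intro z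
      rw [star_smul, smul_dotProduct, Complex.star_def, Complex.conj_ofReal, smul_eq_mul,
        Complex.re_ofReal_mul]
    -- For `x ⟂ b`, `|xᴴ h|² = |xᴴ (h - b)|² ≤ r ‖h - b‖²`. Expanding about `h_m` and using `‖h -
    -- h_m‖ ≤ ε_m` leaves a bound affine in `h`, which integrates through mass and first moment
    -- alone.
    have := hy (integral (-1) x (((-2 * r : ℝ) : ℂ) • e)
        (r * (D.ε m ^ 2 + l2 e ^ 2 + 2 * (star e ⬝ᵥ D.H.col m).re))) fun h hh => by
      rw [integral_pointMass, hk]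
      have h1 : star x ⬝ᵥ h = star x ⬝ᵥ (h - b) := by
        have : star x ⬝ᵥ b = 0 := by rw [star_dotProduct, hx, star_zero]
        rw [dotProduct_sub, this, sub_zero]
      have h2 := (norm_star_dotProduct_sq_le x (h - b)).trans
        (mul_le_mul_of_nonneg_right hxr (sq_nonneg _))
      have h3 := l2_sub_col_le hh
      have h4 : h - b = (h - D.H.col m) - e := by rw [he]; abel
      rw [← h1, h4, l2_sq_sub (h - D.H.col m) e, dotProduct_sub, Complex.sub_re] at h2
      nlinarith [mul_le_mul_of_nonneg_left h3 hr0]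
    rw [integral_apply, hk] at this
    have h5 : (star e ⬝ᵥ ((c : ℂ) • b)).re = c * (l2 e ^ 2 + (star e ⬝ᵥ D.H.col m).re) := by
      have : b = e + D.H.col m := by rw [he]; abel
      rw [dotProduct_smul, smul_eq_mul, Complex.re_ofReal_mul]
      nth_rewrite 1 [this]
      rw [dotProduct_add, star_dotProduct_self, Complex.add_re, Complex.ofReal_re]
    simp only [h5] at this
    linarith

/-- With `T = ∑ t_i` the hypotheses read `M t_j ≤ 1 + T` and `M t_m + M < 1 + T`. Adding the former
over `j ≠ m` to the latter gives `M T + M < M (1 + T)`. -/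
lemma not_forall_multiplier_bounds {t : Fin M → ℝ} (m : Fin M)
    (h : ∀ j, (M - 1) * t j ≤ 1 + ∑ i ∈ Finset.univ.erase j, t i)
    (hm : (M - 1) * t m + M < 1 + ∑ i ∈ Finset.univ.erase m, t i) : False := by
  have hs : ∀ j, ∑ i ∈ Finset.univ.erase j, t i = (∑ i, t i) - t j := fun j => by
    rw [← Finset.add_sum_erase _ t (Finset.mem_univ j)]; ring
  have h1 : ∑ j ∈ Finset.univ.erase m, (M : ℝ) * t j ≤
      ∑ j ∈ Finset.univ.erase m, (1 + ∑ i, t i) :=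
    Finset.sum_le_sum fun j _ => by linarith [h j, hs j]
  rw [← Finset.mul_sum, hs, Finset.sum_const, Finset.card_erase_of_mem (Finset.mem_univ m),
    Finset.card_univ, Fintype.card_fin, nsmul_eq_mul, Nat.cast_sub m.pos] at h1
  rw [hs] at hm
  push_cast at h1
  nlinarith

lemma rank_eq_one_of_isZeroForcing (D : Scenario N M) (hε : ∀ m, 0 < D.ε m)
    (hσ : ∀ m, 0 < D.σ m) (hγ : ∀ m, 0 < D.γ m) {B : Finset (Fin N)}
    {u : Fin M → Fin N → ℂ} (hu : ∀ m, IsZeroForcing D B m (u m))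
    {X : Fin M → Matrix (Fin N) (Fin N) ℂ} (hX : IsOptimal sdrPower (sdrFeasible D B) X)
    (m : Fin M) : (X m).rank = 1 := by
  obtain ⟨X₀, hX₀, hslater⟩ := exists_strictly_feasible D hγ hu
  obtain ⟨y, hy, hnonneg, hcompl⟩ := exists_sdr_multiplier D hε hσ hγ B hX hX₀ hslater
  obtain ⟨⟨hpsd, hrow⟩, hfeas⟩ := (mem_sdrFeasible_iff D hε hσ B X).1 hX.1
  have hM : (0 : ℝ) < M := by exact_mod_cast m.pos
  have hc : ∀ j, 0 ≤ (y j).2.2 := fun j => by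
    have := hy j (integral 0 0 0 1) fun h hh => by rw [integral_pointMass]; simp
    simpa [integral_apply] using this
  have hSnonneg : ∀ j x, 0 ≤ quad (y j).1 x := fun j x => by
    have := hy j (integral 1 x 0 0) fun h hh => by
      rw [integral_pointMass]; simp
    simpa [integral_apply] using this
  have hdir : ∀ j x, (∀ n ∈ B, x n = 0) → quad (y j).1 x / D.γ j -
      ∑ i ∈ Finset.univ.erase j, quad (y i).1 x ≤ l2 x ^ 2 := fun j x hx => by
    have := hnonneg j _ (posSemidef_vecMulVec_self_star x)
      fun n hn => vecMulVec_row_eq_zero (hx n hn)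
    simpa only [trForm_vecMulVec, trace_vecMulVec_star] using this
  -- Dual feasibility is tested at `u j`: interference is bounded by masses, the useful term from
  -- below through the barycenter. The parameter `θ` is a lower bound on the variance budget left at
  -- `b`; it is used with `0` for all users and with `γ m` for a user of rank at least two.
  have hkey : ∀ j b θ, 0 < (y j).2.2 → (∀ x, (y j).2.2 * ‖star x ⬝ᵥ b‖ ^ 2 ≤ quad (y j).1 x) →
      (y j).2.2 * l2 (b - D.H.col j) ^ 2 + θ ≤ D.ε j ^ 2 * (y j).2.2 →
      (M - 1) * (D.ε j ^ 2 * (y j).2.2) * D.γ j + M * θ <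
        D.γ j * (1 + ∑ i ∈ Finset.univ.erase j, D.ε i ^ 2 * (y i).2.2) := by
    intro j b θ hcj hb hθ
    have hγj := hγ j
    have hd := (hu j).l2_sq_pos hγj
    have h1 := (hu j).le_norm_dot_sq b
    have h2 := hdir j (u j) (hu j).apply_eq_zero
    have h3 : ∑ i ∈ Finset.univ.erase j, quad (y i).1 (u j) ≤
        (∑ i ∈ Finset.univ.erase j, D.ε i ^ 2 * (y i).2.2) * l2 (u j) ^ 2 := by
      rw [Finset.sum_mul]
      refine Finset.sum_le_sum fun i hi => ?_
      have := quad_le_of_mass D (hy i) fun h hh =>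
        (hu j).norm_dot_sq_le (Finset.ne_of_mem_erase hi) hh
      linarith
    have hbd := (hu j).bound
    have h4 := hb (u j)
    generalize ∑ i ∈ Finset.univ.erase j, D.ε i ^ 2 * (y i).2.2 = ys at *
    generalize ∑ i ∈ Finset.univ.erase j, quad (y i).1 (u j) = qs at *
    generalize quad (y j).1 (u j) = q at *
    generalize ‖star (u j) ⬝ᵥ b‖ ^ 2 = g at *
    generalize l2 (b - D.H.col j) ^ 2 = ρ at *
    generalize l2 (u j) ^ 2 = d at *
    generalize (y j).2.2 = c at *
    generalize D.γ j = γ at *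
    generalize D.ε j ^ 2 = E at *
    have h5 : q ≤ γ * (d * (1 + ys)) := by
      have : q / γ ≤ d * (1 + ys) := by linarith
      rwa [div_le_iff₀ hγj, mul_comm] at this
    have h6 : c * d ≤ (1 + 1 / M) * (γ * (1 + ys)) + (1 + M) * (c * ρ) := by
      refine le_of_mul_le_mul_right ?_ hd
      have h7 := mul_le_mul_of_nonneg_left h1 hcj.le
      have h8 : (1 + 1 / (M : ℝ)) * (c * g) ≤ (1 + 1 / M) * (γ * (d * (1 + ys))) :=
        mul_le_mul_of_nonneg_left (h4.trans h5) (by positivity)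
      linarith
    have h9 := mul_lt_mul_of_pos_left hbd hcj
    have h10 : (1 + (M : ℝ)) * (c * ρ) ≤ (1 + M) * (E * c - θ) :=
      mul_le_mul_of_nonneg_left (by linarith) (by positivity)
    have h11 : (1 + 1 / (M : ℝ)) * ((M - 1) * (E * c) * γ + M * θ) <
        (1 + 1 / M) * (γ * (1 + ys)) := by
      have : (1 + 1 / (M : ℝ)) * (M * θ) = (1 + M) * θ := by field_simp; ring
      linarith
    exact lt_of_mul_lt_mul_left h11 (by positivity)
  have hbound : ∀ j, (M - 1) * (D.ε j ^ 2 * (y j).2.2) ≤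
      1 + ∑ i ∈ Finset.univ.erase j, D.ε i ^ 2 * (y i).2.2 := by
    intro j
    rcases (hc j).eq_or_lt with h0 | hpos
    · rw [← h0, mul_zero, mul_zero]
      exact add_nonneg zero_le_one
        (Finset.sum_nonneg fun i _ => mul_nonneg (sq_nonneg _) (hc i))
    · obtain ⟨b, hb1, hb2⟩ := exists_barycenter D (hy j) hpos
      have h1 := hkey j b 0 hpos hb1 (by
        -- With `x = 0` and `r = 1` the variance bound says that the barycenter stays in the ball.
        have := hb2 0 1 (by simp) (by simp [l2])
        linarith [hSnonneg j 0])
      rw [mul_zero, add_zero, mul_comm] at h1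
      exact (lt_of_mul_lt_mul_left h1 (hγ j).le).le
  have hne : X m ≠ 0 := by
    intro h0
    have := hfeas m _ (col_mem_uncertainty D (hε m))
    rw [h0] at this
    have h1 : 0 < D.γ m * (∑ j ∈ Finset.univ.erase m, quad (X j) (D.H.col m) + D.σ m ^ 2) :=
      mul_pos (hγ m) (add_pos_of_nonneg_of_pos
        (Finset.sum_nonneg fun j _ => quad_nonneg (hpsd j) _) (pow_pos (hσ m) 2))
    have h2 : quad (0 : Matrix (Fin N) (Fin N) ℂ) (D.H.col m) = 0 := by simp [quad]
    linarith
  -- Some `δ x xᴴ` with `x = X_m z` can be split off `X_m`. The slack vanishes on `X_m` and is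
  -- nonnegative on the remainder, so it is nonpositive at `x`; the interference terms in it are
  -- nonnegative and can be dropped.
  have hrange : ∀ z, D.γ m * l2 (X m *ᵥ z) ^ 2 ≤ quad (y m).1 (X m *ᵥ z) := by
    intro z
    obtain ⟨δ, hδ, hsub⟩ := exists_posSemidef_sub (hpsd m) z
    have hx : ∀ n ∈ B, (X m *ᵥ z) n = 0 := fun n hn => by
      rw [mulVec, hrow m n hn, zero_dotProduct]
    have h1 := hnonneg m _ hsub fun n hn => by
      change X m n - δ • vecMulVec (X m *ᵥ z) (star (X m *ᵥ z)) n = 0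
      rw [hrow m n hn, vecMulVec_row_eq_zero (hx n hn), smul_zero, sub_zero]
    have h2 := hcompl m
    simp only [map_sub, map_smul, trForm_vecMulVec, ← trForm_one, smul_eq_mul,
      Finset.sum_sub_distrib, ← Finset.mul_sum] at h1 h2
    have h3 : quad 1 (X m *ᵥ z) = l2 (X m *ᵥ z) ^ 2 := by
      rw [quad, one_mulVec, star_dotProduct_self, Complex.ofReal_re]
    have h4 : 0 ≤ ∑ i ∈ Finset.univ.erase m, quad (y i).1 (X m *ᵥ z) :=
      Finset.sum_nonneg fun i _ => hSnonneg i _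
    rw [sub_div, mul_div_assoc, h3] at h1
    have h5 : δ * l2 (X m *ᵥ z) ^ 2 ≤ δ * (quad (y m).1 (X m *ᵥ z) / D.γ m) := by
      linarith [mul_nonneg hδ.le h4]
    have h6 := le_of_mul_le_mul_left h5 hδ
    rwa [le_div_iff₀ (hγ m), mul_comm] at h6
  refine le_antisymm (not_lt.1 fun hrank => ?_) ?_
  · rcases (hc m).eq_or_lt with h0 | hpos
    -- A measure of mass zero on a bounded set has zero second moment, against `hrange`; any nonzero
    -- vector of the range will do.
    · obtain ⟨z, hz, -⟩ := exists_range_orthogonal hrank 0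
      have hC : ∀ h ∈ uncertainty D m, ‖star (X m *ᵥ z) ⬝ᵥ h‖ ^ 2 ≤
          2 * (‖star (X m *ᵥ z) ⬝ᵥ D.H.col m‖ ^ 2 + l2 (X m *ᵥ z) ^ 2 * D.ε m ^ 2) := by
        intro h hh
        have h1 := norm_sq_le_young one_pos (star (X m *ᵥ z) ⬝ᵥ h) (star (X m *ᵥ z) ⬝ᵥ D.H.col m)
        rw [← dotProduct_sub] at h1
        have h2 := norm_star_dotProduct_sq_le (X m *ᵥ z) (h - D.H.col m)
        have h3 := mul_le_mul_of_nonneg_left (l2_sub_col_le hh) (sq_nonneg (l2 (X m *ᵥ z)))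
        rw [← neg_sub h, dotProduct_neg, norm_neg] at h1
        linarith
      have h1 := quad_le_of_mass D (hy m) hC
      rw [← h0, mul_zero] at h1
      have := mul_pos (hγ m) (pow_pos (l2_pos hz) 2)
      linarith [hrange z]
    · obtain ⟨b, hb1, hb2⟩ := exists_barycenter D (hy m) hpos
      obtain ⟨z, hz, hbz⟩ := exists_range_orthogonal hrank b
      have hr : 0 < l2 (X m *ᵥ z) ^ 2 := pow_pos (l2_pos hz) 2
      -- The range vector orthogonal to `b` has second moment at least `γ_m ‖x‖²`, so the variance
      -- bound holds with `θ = γ_m` to spare.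
      have h1 := hkey m b (D.γ m) hpos hb1 (by
        have := hb2 _ _ hbz le_rfl
        refine le_of_mul_le_mul_right ?_ hr
        linarith [hrange z])
      refine not_forall_multiplier_bounds m hbound ?_
      refine lt_of_mul_lt_mul_left ?_ (hγ m).le
      linarith
  · refine Submodule.one_le_finrank_iff.2 fun h0 => hne ?_
    have h1 : (X m).mulVecLin = 0 := LinearMap.range_eq_bot.1 h0
    exact Matrix.mulVec_injective (by
      funext z
      rw [zero_mulVec]
      exact LinearMap.congr_fun h1 z)

theorem solvedBySDR (D : Scenario N M) (hε : ∀ m, 0 < D.ε m) (hσ : ∀ m, 0 < D.σ m)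
    (hγ : ∀ m, 0 < D.γ m) (hD : ChannelCondition D L) {B : Finset (Fin N)}
    (hB : B.card + L ≤ N) : SolvedBySDR D B := by
  choose u hu using exists_isZeroForcing D hε hD hB
  exact solvedBySDR_of_rank D hε hσ B fun X hX =>
    rank_eq_one_of_isZeroForcing D hε hσ hγ hu hX

end AntennaSelection

end

open AntennaSelection in
theorem lemma3 {N M L : ℕ} (D : Scenario N M)
    (hσ : ∀ m, 0 < D.σ m) (hγ : ∀ m, 0 < D.γ m) :
    (∀ ν : Node N L, SolvedBySOCP D ν.B) ∧
    ((∀ m, 0 < D.ε m) → ChannelCondition D L → ∀ ν : Node N L, SolvedBySDR D ν.B) ∧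
    (∀ ν : Node N L, ValidUpperBound D .BF ν (SolvedBySOCP D)) ∧
    ((∀ m, 0 < D.ε m) → ChannelCondition D L →
      ∀ ν : Node N L, ValidUpperBound D .RBF ν (SolvedBySDR D)) :=
  ⟨fun ν => solvedBySOCP D hσ hγ ν.B,
    fun hε hD ν => solvedBySDR D hε hσ hγ hD ν.card_B,
    fun ν => validUpperBound D .BF ν fun B _ => solvedBySOCP D hσ hγ B,
    fun hε hD ν => validUpperBound D .RBF ν fun _ hB => solvedBySDR D hε hσ hγ hD hB⟩
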